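/- Let $B$ be a compact (Hausdorff) $n$-dimensional special integral affine manifold without boundary, i.e. a manifold with an atlas whose transition functions are locally of the form $x\mapsto Ax+b$ with $A\in SL(n,\mathbb Z)$, $b\in\mathbb R^n$. Let $\Lambda^*\subset T^*B$ be the lattice bundle generated by the differentials $dx^1,\dots,dx^n$ of local affine coordinates, let $p:X:=T^*B/\Lambda^*\to B$ be the associated torus fibration, and let $L_0\subset X$ be its zero section. Let $g$ be an integral Riemannian metric of Hessian type on $B$: there are an open cover $\{U\}$ of $B$ by affine charts with coordinates $x_U$ and smooth functions $\phi_U$ with $g=\sum_{j,k}\frac{\partial^2\phi_U}{\partial x^j\partial x^k}dx^j\otimes dx^k$ on $U$ such that on each overlap $\phi_U-\phi_V=\langle m_{UV},x_V\rangle+a_{UV}$ for some $m_{UV}\in\mathbb Z^n$ and $a_{UV}\in\mathbb R$. Fix such potentials, and let $L_g:=\{(x,[d\phi_U(x)]):x\in U\}\subset X$ be the resulting Lagrangian section. Let $P(L_0,L_g):=\coprod_{x\in B}\pi_1(p^{-1}(x);L_0,L_g)$ be the set of homotopy classes, within the fibers $p^{-1}(x)$, of paths from $L_0$ to $L_g$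 contained in a fiber, with the quotient of the compact-open topology. It is a covering space of $B$ and carries the affine structure pulled back from $B$. The area function $\mathcal A$ (which may be multivalued) on $P(L_0,L_g)$ has as differential the 1-form $d\mathcal A(x,\gamma)=\dot\gamma\lrcorner\omega$, where $\omega=\sum_j dy_j\wedge dx^j$; that is, if $\gamma(t)=[\beta+t\alpha]$ is a geodesic representative with $\alpha,\beta\in T^*_xB$, then $d\mathcal A(x,\gamma)=\alpha$. A critical point is a zero of $d\mathcal A$. Each $p\in L_0\cap L_g$ is regarded as the point of $P(L_0,L_g)$ given by the constant path at $p$; let $P_p(L_0,L_g)$ be its connected component. Suppose that $B$ is complete, i.e. that its universal cover is affinely diffeomorphic to $\mathbb R^n$. Then there is a decomposition into disjoint open and closed subsets $$P(L_0,L_g)=P\amalg\coprod_{p\in L_0\cap L_g}P_p(L_0,L_g),$$ where $P$ contains no critical points of $\mathcal A$. In particular, $P_p(L_0,L_g)\cap P_q(L_0,L_g)=\emptyset$ for distinct intersection points $p\ne q$. Moreover, each $P_p(L_0,L_g)$ is contractible and is isomorphic to $\mathbb R^n$ as an affine manifold. -/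

import Mathlib

open Set Topology Bundle
open scoped Manifold ContDiff

noncomputable section

namespace SYZ

/-! ### Special integral affine manifolds -/

/-- The pregroupoid of maps of `ℝⁿ` which are locally of the form `y ↦ A y + b` with
`A ∈ SL(n, ℤ)` and `b ∈ ℝⁿ`. -/
def integralAffinePregroupoid (n : ℕ) : Pregroupoid (Fin n → ℝ) where
  property f s := ∀ x ∈ s, ∃ (A : Matrix.SpecialLinearGroup (Fin n) ℤ) (b : Fin n → ℝ)
    (u : Set (Fin n → ℝ)), IsOpen u ∧ x ∈ u ∧
      ∀ y ∈ s ∩ u, f y = ((A : Matrix (Fin n) (Fin n) ℤ).map (Int.cast : ℤ → ℝ)).mulVec y + b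
  comp := by
    intro f g s t hf hg _ _ hst x hx
    obtain ⟨A, b, u, hu, hxu, hA⟩ := hf x hx.1
    obtain ⟨A', b', u', hu', hxu', hA'⟩ := hg (f x) hx.2
    refine ⟨A' * A, ((A' : Matrix (Fin n) (Fin n) ℤ).map (Int.cast : ℤ → ℝ)).mulVec b + b',
      u ∩ (fun y => ((A : Matrix (Fin n) (Fin n) ℤ).map (Int.cast : ℤ → ℝ)).mulVec y + b) ⁻¹' u',
      ?_, ⟨hxu, ?_⟩, ?_⟩
    · refine hu.inter (hu'.preimage ?_)
      exact (Continuous.matrix_mulVec continuous_const continuous_id).add continuous_const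
    · have h := hA x ⟨hx.1, hxu⟩
      rw [h] at hxu'
      exact hxu'
    · rintro y ⟨⟨hys, hyt⟩, hyu, hyu'⟩
      have h1 := hA y ⟨hys, hyu⟩
      have h2 : f y ∈ u' := by rw [h1]; exact hyu'
      have h3 := hA' (f y) ⟨hyt, h2⟩
      have h4 : ((A' * A : Matrix.SpecialLinearGroup (Fin n) ℤ) : Matrix (Fin n) (Fin n) ℤ).map
          (Int.cast : ℤ → ℝ) = (A' : Matrix (Fin n) (Fin n) ℤ).map (Int.cast : ℤ → ℝ) *
            (A : Matrix (Fin n) (Fin n) ℤ).map (Int.cast : ℤ → ℝ) := by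
        rw [Matrix.SpecialLinearGroup.coe_mul]
        exact Matrix.map_mul (f := Int.castRingHom ℝ)
      rw [Function.comp_apply, h3, h1, h4, Matrix.mulVec_add, Matrix.mulVec_mulVec, add_assoc]
  id_mem := by
    intro x _
    refine ⟨1, 0, univ, isOpen_univ, mem_univ _, ?_⟩
    intro y _
    simp
  locality := by
    intro f u _ h x hx
    obtain ⟨v, hv, hxv, H⟩ := h x hx
    obtain ⟨A, b, w, hw, hxw, hA⟩ := H x ⟨hx, hxv⟩
    exact ⟨A, b, v ∩ w, hv.inter hw, ⟨hxv, hxw⟩,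
      fun y hy => hA y ⟨⟨hy.1, hy.2.1⟩, hy.2.2⟩⟩
  congr := by
    intro f g u _ h H x hx
    obtain ⟨A, b, w, hw, hxw, hA⟩ := H x hx
    exact ⟨A, b, w, hw, hxw, fun y hy => by rw [h y hy.1, hA y hy]⟩

/-- The structure groupoid on `ℝⁿ` of local homeomorphisms which are locally in
`SL(n, ℤ) ⋉ ℝⁿ`. A special integral affine manifold of dimension `n` is a space charted on `ℝⁿ`
with transition functions in this groupoid. -/
def specialIntegralAffineGroupoid (n : ℕ) : StructureGroupoid (Fin n → ℝ) :=
  (integralAffinePregroupoid n).groupoid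

theorem contDiffOn_of_property {n : ℕ} {f : (Fin n → ℝ) → (Fin n → ℝ)} {s : Set (Fin n → ℝ)}
    (h : (integralAffinePregroupoid n).property f s) : ContDiffOn ℝ ∞ f s := by
  intro x hx
  obtain ⟨A, b, u, hu, hxu, hA⟩ := h x hx
  have h1 : ContDiff ℝ ∞ (fun y : Fin n → ℝ =>
      ((A : Matrix (Fin n) (Fin n) ℤ).map (Int.cast : ℤ → ℝ)).mulVec y + b) :=
    (((A : Matrix (Fin n) (Fin n) ℤ).map (Int.cast : ℤ → ℝ)).mulVecLin.toContinuousLinearMap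
      |>.contDiff).add contDiff_const
  refine (h1.contDiffWithinAt (s := s)).congr_of_eventuallyEq ?_ (hA x ⟨hx, hxu⟩)
  filter_upwards [self_mem_nhdsWithin, mem_nhdsWithin_of_mem_nhds (hu.mem_nhds hxu)] with y hy hyu
  exact hA y ⟨hy, hyu⟩

theorem specialIntegralAffineGroupoid_le (n : ℕ) :
    specialIntegralAffineGroupoid n ≤ contDiffGroupoid ∞ 𝓘(ℝ, Fin n → ℝ) := by
  refine StructureGroupoid.le_iff.2 ?_
  intro e he
  rw [contDiffGroupoid, mem_groupoid_of_pregroupoid]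
  have he' := (mem_groupoid_of_pregroupoid (PG := integralAffinePregroupoid n)).1 he
  constructor
  · simpa [contDiffPregroupoid] using contDiffOn_of_property he'.1
  · simpa [contDiffPregroupoid] using contDiffOn_of_property he'.2

section Base

variable {n : ℕ} {B : Type*} [TopologicalSpace B] [ChartedSpace (Fin n → ℝ) B]

/-- A special integral affine manifold is a smooth manifold. -/
instance isManifold_of_affine [HasGroupoid B (specialIntegralAffineGroupoid n)] :
    IsManifold 𝓘(ℝ, Fin n → ℝ) ∞ B :=
  have := hasGroupoid_of_le (M := B) inferInstance (specialIntegralAffineGroupoid_le n)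
  IsManifold.mk' _ _ _

/-- `f : ℝⁿ → B` is a local affine isomorphism: near every point, in affine coordinates of `B`, it
is given by an invertible affine map. -/
def IsLocalAffineIso (f : (Fin n → ℝ) → B) : Prop :=
  ∀ v : Fin n → ℝ, ∃ A : (Fin n → ℝ) ≃ᵃ[ℝ] (Fin n → ℝ),
    ∀ᶠ w in 𝓝 v, f w ∈ (chartAt (Fin n → ℝ) (f v)).source ∧
      chartAt (Fin n → ℝ) (f v) (f w) = A w

variable (n B) in
/-- `B` is complete: its universal cover, with the pulled back affine structure, is affinely
diffeomorphic to `ℝⁿ`; that is, there is a surjective covering map `ℝⁿ → B` which is a local affine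
isomorphism. -/
def IsCompleteAffine : Prop :=
  ∃ q : (Fin n → ℝ) → B, IsCoveringMap q ∧ Function.Surjective q ∧ IsLocalAffineIso q

/-! ### The dual torus fibration `X = T*B / Λ*` -/

variable (n) in
/-- The cotangent space `T*_x B`. -/
abbrev Cotangent (x : B) : Type :=
  TangentSpace 𝓘(ℝ, Fin n → ℝ) x →L[ℝ] Trivial B ℝ x

variable (n B) in
/-- The cotangent bundle `T*B`, with the topology of the bundle of continuous linear maps from the
tangent bundle to the trivial line bundle. -/
abbrev CotangentBundle : Type _ :=
  TotalSpace ((Fin n → ℝ) →L[ℝ] ℝ) (fun x : B => Cotangent n x)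

/-- The differential at `x` of a real function on `B`. -/
def differential (f : B → ℝ) (x : B) : Cotangent n x :=
  mfderiv 𝓘(ℝ, Fin n → ℝ) 𝓘(ℝ, ℝ) f x

variable (n) in
/-- The lattice `Λ*_x ⊂ T*_x B` generated by the differentials at `x` of the affine coordinates
around `x`. (Transition functions being integral affine, any chart around `x` gives the same
lattice.) -/
def dualLattice (x : B) : AddSubgroup (Cotangent n x) :=
  AddSubgroup.closure
    (range fun j : Fin n => differential (n := n) (fun y : B => chartAt (Fin n → ℝ) x y j) x)

variable (n B) in
/-- Two covectors at the same point of `B` are equivalent if they differ by an element of `Λ*`. -/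
def latticeSetoid : Setoid (CotangentBundle n B) where
  r a b := ∃ l ∈ dualLattice n a.proj, b = ⟨a.proj, a.2 + l⟩
  iseqv :=
    { refl := fun a => ⟨0, zero_mem _, by simp⟩
      symm := by
        rintro ⟨x, a⟩ _ ⟨l, hl, rfl⟩
        exact ⟨-l, neg_mem hl, by simp⟩
      trans := by
        rintro ⟨x, a⟩ _ _ ⟨l, hl, rfl⟩ ⟨l', hl', rfl⟩
        exact ⟨l + l', add_mem hl hl', by simp [add_assoc]⟩ }

variable [HasGroupoid B (specialIntegralAffineGroupoid n)]

variable (n B) in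
/-- The space `X = T*B / Λ*`. -/
def DualFibration : Type _ := Quotient (latticeSetoid n B)

/-- `X` carries the quotient topology. -/
instance : TopologicalSpace (DualFibration n B) :=
  inferInstanceAs (TopologicalSpace (Quotient (latticeSetoid n B)))

/-- The class in `X` of a covector `α ∈ T*_x B`. -/
def DualFibration.mk (x : B) (α : Cotangent n x) : DualFibration n B :=
  Quotient.mk (latticeSetoid n B) ⟨x, α⟩

/-- The torus fibration `p : X → B`. -/
def DualFibration.proj : DualFibration n B → B :=
  Quotient.lift (fun a => a.proj) (by rintro a _ ⟨l, _, rfl⟩; rfl)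

variable (n B) in
/-- The zero section `L₀ ⊂ X`. -/
def zeroSection : Set (DualFibration n B) := range fun x : B => DualFibration.mk x 0

/-! ### Integral Hessian type metrics -/

variable (n B) in
/-- Smooth Riemannian metrics on `B`. -/
abbrev Metric : Type _ :=
  ContMDiffRiemannianMetric 𝓘(ℝ, Fin n → ℝ) ∞ (Fin n → ℝ)
    (fun x : B => TangentSpace 𝓘(ℝ, Fin n → ℝ) x)

/-- A system of local potentials exhibiting the Riemannian metric `g` as an integral metric of
Hessian type: an open cover of `B` by affine charts `U i`, and smooth functions `φ i` in
these affine coordinates whose Hessian is `g`, such that on every overlap two potentials differ by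
an affine function with integral linear part. -/
structure IntegralPotentials (g : Metric n B) where
  /-- The index set of the open cover. -/
  ι : Type*
  /-- The affine coordinates on the members of the cover. -/
  chart : ι → OpenPartialHomeomorph B (Fin n → ℝ)
  chart_mem : ∀ i, chart i ∈ (specialIntegralAffineGroupoid n).maximalAtlas B
  cover : ∀ x, ∃ i, x ∈ (chart i).source
  /-- The potential functions. -/
  φ : ι → (Fin n → ℝ) → ℝ
  smooth : ∀ i, ContDiffOn ℝ ∞ (φ i) (chart i).target
  hessian : ∀ i, ∀ x ∈ (chart i).source, ∀ v w : TangentSpace 𝓘(ℝ, Fin n → ℝ) x,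
    g.inner x v w = fderiv ℝ (fderiv ℝ (φ i)) (chart i x)
      (mfderiv 𝓘(ℝ, Fin n → ℝ) 𝓘(ℝ, Fin n → ℝ) (chart i) x v)
      (mfderiv 𝓘(ℝ, Fin n → ℝ) 𝓘(ℝ, Fin n → ℝ) (chart i) x w)
  integral : ∀ i j, ∃ (m : Fin n → ℤ) (a : ℝ), ∀ x ∈ (chart i).source ∩ (chart j).source,
    φ i (chart i x) - φ j (chart j x) = ∑ k, (m k : ℝ) * chart j x k + a

/-- The Lagrangian section `L_g = {(x, [dφ(x)]) : x ∈ B} ⊂ X`. -/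
def IntegralPotentials.lagrangian {g : Metric n B} (Φ : IntegralPotentials g) :
    Set (DualFibration n B) :=
  {q | ∃ i, ∃ x ∈ (Φ.chart i).source,
    q = DualFibration.mk x (differential (fun y => Φ.φ i (Φ.chart i y)) x)}

/-! ### The fiberwise geodesic path space -/

/-- A path in the fiber `p⁻¹(x)` from `L₁` to `L₂`. -/
def IsFiberPath (L₁ L₂ : Set (DualFibration n B)) (x : B)
    (γ : C(unitInterval, DualFibration n B)) : Prop :=
  (∀ t, (γ t).proj = x) ∧ γ 0 ∈ L₁ ∧ γ 1 ∈ L₂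

/-- The space, with the compact-open topology, of all paths from `L₁` to `L₂` contained in some
fiber of `p : X → B`. -/
abbrev FiberPath (L₁ L₂ : Set (DualFibration n B)) : Type _ :=
  {γ : C(unitInterval, DualFibration n B) // ∃ x, IsFiberPath L₁ L₂ x γ}

/-- Two such paths are equivalent if they lie in the same fiber `p⁻¹(x)` and are homotopic through
paths in `p⁻¹(x)` from `L₁` to `L₂`. -/
def fiberHomotopySetoid (L₁ L₂ : Set (DualFibration n B)) : Setoid (FiberPath L₁ L₂) where
  r γ γ' := ∃ x, ContinuousMap.HomotopicWith γ.1 γ'.1 (IsFiberPath L₁ L₂ x)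
  iseqv :=
    { refl := fun ⟨γ, x, hx⟩ => ⟨x, ContinuousMap.HomotopicWith.refl γ hx⟩
      symm := fun ⟨x, h⟩ => ⟨x, h.symm⟩
      trans := by
        rintro a b c ⟨x, ⟨h⟩⟩ ⟨y, ⟨h'⟩⟩
        have h1 : IsFiberPath L₁ L₂ x b.1 := by
          have := h.prop' 1
          convert this using 1
          ext t
          simp
        have h2 : IsFiberPath L₁ L₂ y b.1 := by
          have := h'.prop' 0
          convert this using 1
          ext t
          simp
        have hxy : x = y := (h1.1 0).symm.trans (h2.1 0)
        subst hxy
        exact ⟨x, ContinuousMap.HomotopicWith.trans ⟨h⟩ ⟨h'⟩⟩ }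

/-- The fiberwise path space `P(L₁, L₂) = ∐ₓ π₁(p⁻¹(x); L₁, L₂)`, the set of homotopy classes of
paths from `L₁` to `L₂` in the fibers of `p`, with the quotient of the compact-open topology. -/
def PathSpace (L₁ L₂ : Set (DualFibration n B)) : Type _ := Quotient (fiberHomotopySetoid L₁ L₂)

instance (L₁ L₂ : Set (DualFibration n B)) : TopologicalSpace (PathSpace L₁ L₂) :=
  inferInstanceAs (TopologicalSpace (Quotient (fiberHomotopySetoid L₁ L₂)))

namespace PathSpace

variable {L₁ L₂ : Set (DualFibration n B)}

/-- The class in `P(L₁, L₂)` of a path in a fiber. -/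
def mk (γ : FiberPath L₁ L₂) : PathSpace L₁ L₂ := Quotient.mk (fiberHomotopySetoid L₁ L₂) γ

/-- The projection `P(L₁, L₂) → B`. -/
def proj : PathSpace L₁ L₂ → B :=
  Quotient.lift (fun γ => (γ.1 0).proj) (by
    rintro a b ⟨x, ⟨h⟩⟩
    have h1 := (h.prop' 0).1 0
    have h2 := (h.prop' 1).1 0
    simp at h1 h2
    exact h1.trans h2.symm)

/-- An intersection point of `L₁` and `L₂`, seen as (the class of) a constant path. -/
def ofPoint (p : ↥(L₁ ∩ L₂)) : PathSpace L₁ L₂ :=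
  mk ⟨ContinuousMap.const _ p.1, p.1.proj, fun _ => rfl, p.2.1, p.2.2⟩

/-- The connected component `P_p(L₁, L₂)` of the intersection point `p`. -/
def component (p : ↥(L₁ ∩ L₂)) : Set (PathSpace L₁ L₂) := connectedComponent (ofPoint p)

/-- The differential `d𝒜` of the area function, a 1-form on `P(L₁, L₂)`. At the class `c` of a path
in `p⁻¹(x) = T*_x B / Λ*_x` it is `γ̇ ⌟ ω`, where `γ(t) = [β + t α]` is a geodesic in the class `c`
and `ω = ∑ dy_j ∧ dx^j`; so it is the covector `α` (pulled back along the local diffeomorphism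
`P(L₁, L₂) → B`). -/
def areaDifferential (c : PathSpace L₁ L₂) : Cotangent n c.proj :=
  Classical.epsilon fun α => ∃ (γ : FiberPath L₁ L₂) (β : Cotangent n c.proj), mk γ = c ∧
    ∀ t : unitInterval, γ.1 t = DualFibration.mk c.proj (β + (t : ℝ) • α)

/-- `c` is a critical point of the (multivalued) area function: a zero of its differential. -/
def IsCritical (c : PathSpace L₁ L₂) : Prop := c.areaDifferential = 0

/-- A subset of `P(L₁, L₂)` is affinely isomorphic to `ℝⁿ`, where `P(L₁, L₂)` carries the affine
structure for which the projection to `B` is a local affine isomorphism. -/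
def IsAffinelyEuclidean (S : Set (PathSpace L₁ L₂)) : Prop :=
  ∃ h : (Fin n → ℝ) ≃ₜ S, IsLocalAffineIso fun v => (h v).1.proj

end PathSpace

end Base

end SYZ

end

/-! A fiber path starting on `L₀` lifts to `T*B` from a zero covector. The endpoint of the lift
determines the homotopy class, because the fibers of `T*B` are vector spaces and `L_g` meets each
fiber of `X` only once. So `P(L₀, L_g)` is the preimage of `L_g` in `T*B` (`PathSpace.homeomorph`).
Since `T*B → X` is a covering (`isCoveringMap_toDualFibration`) and `L_g` is a section, `P(L₀, L_g)
→ B` is a covering. Intersection points correspond to zero covectors, and every critical point is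
one of them.

Let `q : ℝⁿ → B` be the affine covering given by completeness. It lifts through every point of
`P(L₀, L_g)`, and the image of a lift `σ` is a whole component (`connectedComponent_eq_range`). Such
a lift is a field of covectors along `q`. Pulled back to `ℝⁿ`, it is locally the differential of a
potential in affine coordinates plus a constant covector. Along a line with direction `u`, its
pairing with `u` therefore has derivative `Hess φ (u, u) > 0`, so it increases strictly
(`strictMono_lift`) and the field vanishes at most once (`eq_of_lift_eq_zero`).

Hence a component contains at most one intersection point. If it contains one, `σ` takes that value
once, which for a lift between coverings forces injectivity (`injective_of_lift`). So `σ` identifies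
`ℝⁿ` with the component, affinely because `σ` lies over `q`. All components are open, and `P` is the
union of those without intersection points. -/

noncomputable section

namespace SYZ

section

variable {n : ℕ} {B : Type*} [TopologicalSpace B] [ChartedSpace (Fin n → ℝ) B]

/-! ### Frames of the cotangent bundle given by charts -/

/-- The dual space of `ℝⁿ`. -/
abbrev Covector (n : ℕ) : Type := (Fin n → ℝ) →L[ℝ] ℝ

/-- The derivative at `x` of a chart. -/
def chartDeriv (e : OpenPartialHomeomorph B (Fin n → ℝ)) (x : B) :
    TangentSpace 𝓘(ℝ, Fin n → ℝ) x →L[ℝ] (Fin n → ℝ) :=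
  mfderiv 𝓘(ℝ, Fin n → ℝ) 𝓘(ℝ, Fin n → ℝ) e x

/-- The derivative of the inverse of a chart, at the image of `x`. -/
def chartDerivSymm (e : OpenPartialHomeomorph B (Fin n → ℝ)) (x : B) :
    (Fin n → ℝ) →L[ℝ] TangentSpace 𝓘(ℝ, Fin n → ℝ) x :=
  mfderiv 𝓘(ℝ, Fin n → ℝ) 𝓘(ℝ, Fin n → ℝ) e.symm (e x)

/-- The covector at `x` with components `l` in the frame of a chart. -/
def ofCoord (e : OpenPartialHomeomorph B (Fin n → ℝ)) (x : B) (l : Covector n) :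
    Cotangent n x :=
  l.comp (chartDeriv e x)

/-- The components of a covector in the frame of a chart. -/
def coord (e : OpenPartialHomeomorph B (Fin n → ℝ)) (x : B) :
    Cotangent n x →ₗ[ℝ] Covector n where
  toFun a := a.comp (chartDerivSymm e x)
  map_add' a b := ContinuousLinearMap.add_comp a b _
  map_smul' c a := ContinuousLinearMap.smul_comp c a _

theorem coord_apply (e : OpenPartialHomeomorph B (Fin n → ℝ)) (x : B) (a : Cotangent n x)
    (v : Fin n → ℝ) : coord e x a v = a (chartDerivSymm e x v) := rfl

theorem ofCoord_apply (e : OpenPartialHomeomorph B (Fin n → ℝ)) (x : B) (l : Covector n)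
    (v : TangentSpace 𝓘(ℝ, Fin n → ℝ) x) : ofCoord e x l v = l (chartDeriv e x v) := rfl

theorem mdifferentiable_of_mem_maximalAtlas {e : OpenPartialHomeomorph B (Fin n → ℝ)}
    (he : e ∈ (specialIntegralAffineGroupoid n).maximalAtlas B) :
    e.MDifferentiable 𝓘(ℝ, Fin n → ℝ) 𝓘(ℝ, Fin n → ℝ) := by
  have h : e ∈ IsManifold.maximalAtlas 𝓘(ℝ, Fin n → ℝ) 1 B :=
    StructureGroupoid.maximalAtlas_mono ((specialIntegralAffineGroupoid_le n).trans
      (contDiffGroupoid_le (by simp))) he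
  exact ⟨fun x hx => (mdifferentiableAt_of_mem_maximalAtlas h hx).mdifferentiableWithinAt,
    fun x hx => (mdifferentiableAt_symm_of_mem_maximalAtlas h hx).mdifferentiableWithinAt⟩

section Frame

variable {e : OpenPartialHomeomorph B (Fin n → ℝ)}
  (he : e ∈ (specialIntegralAffineGroupoid n).maximalAtlas B)
include he

theorem chartDeriv_chartDerivSymm {x : B} (hx : x ∈ e.source) (v : Fin n → ℝ) :
    chartDeriv e x (chartDerivSymm e x v) = v :=
  ((mdifferentiable_of_mem_maximalAtlas he).mfderiv hx).apply_symm_apply v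

theorem chartDerivSymm_chartDeriv {x : B} (hx : x ∈ e.source)
    (v : TangentSpace 𝓘(ℝ, Fin n → ℝ) x) : chartDerivSymm e x (chartDeriv e x v) = v :=
  ((mdifferentiable_of_mem_maximalAtlas he).mfderiv hx).symm_apply_apply v

theorem coord_ofCoord {x : B} (hx : x ∈ e.source) (l : Covector n) :
    coord e x (ofCoord e x l) = l := by
  ext1 v
  rw [coord_apply, ofCoord_apply, chartDeriv_chartDerivSymm he hx]

theorem ofCoord_coord {x : B} (hx : x ∈ e.source) (a : Cotangent n x) :
    ofCoord e x (coord e x a) = a := by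
  ext1 v
  rw [ofCoord_apply, coord_apply, chartDerivSymm_chartDeriv he hx]

theorem differential_comp_chart {x : B} (hx : x ∈ e.source) {f : (Fin n → ℝ) → ℝ}
    (hf : DifferentiableAt ℝ f (e x)) :
    differential (fun y => f (e y)) x = ofCoord e x (fderiv ℝ f (e x)) := by
  have h := mfderiv_comp x hf.mdifferentiableAt
    ((mdifferentiable_of_mem_maximalAtlas he).mdifferentiableAt hx)
  rw [mfderiv_eq_fderiv] at h
  exact h

end Frame

/-! ### Integral changes of affine charts -/

/-- The linear map of `ℝⁿ` given by an element of `SL(n, ℤ)`. -/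
def linearPart (A : Matrix.SpecialLinearGroup (Fin n) ℤ) : (Fin n → ℝ) →L[ℝ] (Fin n → ℝ) :=
  ((A : Matrix (Fin n) (Fin n) ℤ).map (Int.cast : ℤ → ℝ)).mulVecLin.toContinuousLinearMap

theorem linearPart_apply (A : Matrix.SpecialLinearGroup (Fin n) ℤ) (v : Fin n → ℝ) :
    linearPart A v = ((A : Matrix (Fin n) (Fin n) ℤ).map (Int.cast : ℤ → ℝ)).mulVec v := rfl

theorem linearPart_mul (A A' : Matrix.SpecialLinearGroup (Fin n) ℤ) (v : Fin n → ℝ) :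
    linearPart (A * A') v = linearPart A (linearPart A' v) := by
  rw [linearPart_apply, linearPart_apply, linearPart_apply, Matrix.mulVec_mulVec,
    Matrix.SpecialLinearGroup.coe_mul]
  congr 1
  exact Matrix.map_mul (f := Int.castRingHom ℝ)

theorem linearPart_one (v : Fin n → ℝ) :
    linearPart (1 : Matrix.SpecialLinearGroup (Fin n) ℤ) v = v := by
  simp [linearPart_apply]

/-- Near a common point, the change of affine coordinates is integral affine. -/
theorem exists_transition {e e' : OpenPartialHomeomorph B (Fin n → ℝ)}
    (he : e ∈ (specialIntegralAffineGroupoid n).maximalAtlas B)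
    (he' : e' ∈ (specialIntegralAffineGroupoid n).maximalAtlas B) {x : B}
    (hx : x ∈ e.source) (hx' : x ∈ e'.source) :
    ∃ (A : Matrix.SpecialLinearGroup (Fin n) ℤ) (b : Fin n → ℝ),
      ∀ᶠ y in 𝓝 x, e' y = linearPart A (e y) + b := by
  have h := StructureGroupoid.compatible_of_mem_maximalAtlas he he'
  have h' := ((mem_groupoid_of_pregroupoid (PG := integralAffinePregroupoid n)).1 h).1
  obtain ⟨A, b, u, hu, hxu, hA⟩ := h' (e x) (by simp [hx, hx'])
  refine ⟨A, b, ?_⟩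
  filter_upwards [e.open_source.mem_nhds hx, e'.open_source.mem_nhds hx',
    (e.continuousAt hx).preimage_mem_nhds (hu.mem_nhds hxu)] with y hy hy' hyu
  have := hA (e y) ⟨by simp [hy, hy'], hyu⟩
  rw [linearPart_apply]
  simpa [hy] using this

/-- The matrix is chosen before `y`: transition maps are locally affine, so one `A` serves a whole
neighbourhood. Comparing continuity of components in two charts depends on this uniformity. -/
theorem exists_chartDeriv_eq {e e' : OpenPartialHomeomorph B (Fin n → ℝ)}
    (he : e ∈ (specialIntegralAffineGroupoid n).maximalAtlas B)
    (he' : e' ∈ (specialIntegralAffineGroupoid n).maximalAtlas B) {x : B}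
    (hx : x ∈ e.source) (hx' : x ∈ e'.source) :
    ∃ A : Matrix.SpecialLinearGroup (Fin n) ℤ,
      ∀ᶠ y in 𝓝 x, ∀ v, chartDeriv e' y v = linearPart A (chartDeriv e y v) := by
  obtain ⟨A, b, h⟩ := exists_transition he he' hx hx'
  refine ⟨A, ?_⟩
  filter_upwards [h.eventually_nhds, e.open_source.mem_nhds hx] with y hy hye v
  have h1 : HasMFDerivAt 𝓘(ℝ, Fin n → ℝ) 𝓘(ℝ, Fin n → ℝ) e y (chartDeriv e y) :=
    ((mdifferentiable_of_mem_maximalAtlas he).mdifferentiableAt hye).hasMFDerivAt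
  have h2 : HasFDerivAt (fun z => linearPart A z + b) (linearPart A) (e y) :=
    (linearPart A).hasFDerivAt.add_const b
  have h3 := (h2.hasMFDerivAt.comp y h1).congr_of_eventuallyEq hy
  have h4 := h3.mfderiv
  exact congrArg (fun f => f v) h4

/-- The dual lattice of `ℤⁿ`. -/
def integralCovectors (n : ℕ) : AddSubgroup (Covector n) where
  carrier := {l | ∃ m : Fin n → ℤ, ∀ v, l v = ∑ k, (m k : ℝ) * v k}
  zero_mem' := ⟨0, by simp⟩
  add_mem' := by
    rintro l l' ⟨m, hm⟩ ⟨m', hm'⟩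
    exact ⟨m + m', fun v => by simp [hm, hm', add_mul, Finset.sum_add_distrib]⟩
  neg_mem' := by
    rintro l ⟨m, hm⟩
    exact ⟨-m, fun v => by simp [hm]⟩

/-- The transpose of an integer matrix preserves `ℤⁿ`. -/
theorem comp_linearPart_mem {l : Covector n} (hl : l ∈ integralCovectors n)
    (A : Matrix.SpecialLinearGroup (Fin n) ℤ) :
    l.comp (linearPart A) ∈ integralCovectors n := by
  obtain ⟨m, hm⟩ := hl
  refine ⟨fun j => ∑ k, m k * (A : Matrix (Fin n) (Fin n) ℤ) k j, fun v => ?_⟩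
  rw [ContinuousLinearMap.comp_apply, hm, linearPart_apply]
  simp only [Matrix.mulVec, dotProduct, Matrix.map_apply, Finset.mul_sum, Int.cast_sum,
    Int.cast_mul, Finset.sum_mul]
  rw [Finset.sum_comm]
  simp only [mul_assoc]

theorem coord_eq_comp {e e' : OpenPartialHomeomorph B (Fin n → ℝ)}
    (he : e ∈ (specialIntegralAffineGroupoid n).maximalAtlas B)
    (he' : e' ∈ (specialIntegralAffineGroupoid n).maximalAtlas B) {x : B}
    (hx : x ∈ e.source) (hx' : x ∈ e'.source) {A : Matrix.SpecialLinearGroup (Fin n) ℤ}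
    (hA : ∀ v, chartDeriv e' x v = linearPart A (chartDeriv e x v)) (a : Cotangent n x) :
    coord e x a = (coord e' x a).comp (linearPart A) := by
  ext1 v
  rw [ContinuousLinearMap.comp_apply, coord_apply, coord_apply]
  conv_rhs => rw [← chartDeriv_chartDerivSymm he hx v, ← hA, chartDerivSymm_chartDeriv he' hx']

theorem coord_mem_of_coord_mem {e e' : OpenPartialHomeomorph B (Fin n → ℝ)}
    (he : e ∈ (specialIntegralAffineGroupoid n).maximalAtlas B)
    (he' : e' ∈ (specialIntegralAffineGroupoid n).maximalAtlas B) {x : B}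
    (hx : x ∈ e.source) (hx' : x ∈ e'.source) {a : Cotangent n x}
    (ha : coord e' x a ∈ integralCovectors n) : coord e x a ∈ integralCovectors n := by
  obtain ⟨A, hA⟩ := exists_chartDeriv_eq he he' hx hx'
  rw [coord_eq_comp he he' hx hx' hA.self_of_nhds]
  exact comp_linearPart_mem ha A

/-! ### Lattice and topology of `T*B` in an arbitrary affine chart -/

variable [HasGroupoid B (specialIntegralAffineGroupoid n)]

/-- `dualLattice` is defined by the preferred chart at `x`. There the claim is a computation with
coordinate differentials; integral transition matrices in both directions carry it to any other
affine chart. -/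
theorem mem_dualLattice_iff {e : OpenPartialHomeomorph B (Fin n → ℝ)}
    (he : e ∈ (specialIntegralAffineGroupoid n).maximalAtlas B) {x : B} (hx : x ∈ e.source)
    {a : Cotangent n x} : a ∈ dualLattice n x ↔ coord e x a ∈ integralCovectors n := by
  have hc := (specialIntegralAffineGroupoid n).chart_mem_maximalAtlas x
  have hxc := mem_chart_source (Fin n → ℝ) x
  have hd (j : Fin n) : differential (n := n) (fun y : B => chartAt (Fin n → ℝ) x y j) x =
      ofCoord (chartAt (Fin n → ℝ) x) x (ContinuousLinearMap.proj j) := by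
    have h : HasFDerivAt (fun v : Fin n → ℝ => v j) (ContinuousLinearMap.proj (R := ℝ) j)
        (chartAt (Fin n → ℝ) x x) :=
      (ContinuousLinearMap.proj (R := ℝ) (φ := fun _ : Fin n => ℝ) j).hasFDerivAt
    rw [← h.fderiv]
    exact differential_comp_chart hc hxc h.differentiableAt
  have key : a ∈ dualLattice n x ↔ coord (chartAt (Fin n → ℝ) x) x a ∈ integralCovectors n := by
    constructor
    · intro ha
      refine (AddSubgroup.closure_le (K := (integralCovectors n).comap
        (coord (chartAt (Fin n → ℝ) x) x).toAddMonoidHom)).2 ?_ ha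
      rintro _ ⟨j, rfl⟩
      simp only [hd]
      change coord (chartAt (Fin n → ℝ) x) x (ofCoord _ x _) ∈ integralCovectors n
      rw [coord_ofCoord hc hxc]
      exact ⟨Pi.single j 1, fun v => by simp [Pi.single_apply]⟩
    · rintro ⟨m, hm⟩
      have h : a = ∑ k, m k • ofCoord (chartAt (Fin n → ℝ) x) x
          (ContinuousLinearMap.proj (R := ℝ) k) := by
        rw [← ofCoord_coord hc hxc a]
        ext1 v
        rw [ofCoord_apply, hm, sum_apply]
        refine Finset.sum_congr rfl fun k _ => ?_
        rw [← Int.cast_smul_eq_zsmul ℝ]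
        rfl
      rw [h]
      refine sum_mem fun k _ => zsmul_mem (AddSubgroup.subset_closure ?_) _
      exact ⟨k, hd k⟩
  exact key.trans ⟨coord_mem_of_coord_mem he hc hx hxc, coord_mem_of_coord_mem hc he hxc hx⟩

/-- This ties the bundle topology of `T*B` to `coord`: the trivialization of the hom bundle
precomposes with the derivative of the inverse chart, and the trivial target contributes the
identity. -/
theorem trivializationAt_cotangent (x₀ : B) (a : CotangentBundle n B)
    (ha : a.proj ∈ (chartAt (Fin n → ℝ) x₀).source) :
    trivializationAt (Covector n) (fun x : B => Cotangent n x) x₀ a =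
      (a.proj, coord (chartAt (Fin n → ℝ) x₀) a.proj a.2) := by
  rw [hom_trivializationAt_apply]
  refine Prod.ext rfl ?_
  ext1 v
  have h := TangentBundle.symmL_trivializationAt (I := 𝓘(ℝ, Fin n → ℝ)) ha
  simp only [ContinuousLinearMap.inCoordinates]
  rw [h]
  simp only [mfld_simps, mfderivWithin_univ]
  have h' : (trivializationAt ℝ (Trivial B ℝ) x₀).continuousLinearMapAt ℝ a.proj =
      ContinuousLinearMap.id ℝ ℝ := Trivial.continuousLinearMapAt_trivialization ℝ B ℝ a.proj
  rw [h']
  rfl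

/-- Frees the topology of `T*B` from preferred charts: near the point, components in two affine
charts differ by composition with a fixed matrix. -/
theorem continuousAt_cotangent_iff {Y : Type*} [TopologicalSpace Y] {f : Y → CotangentBundle n B}
    {y : Y} {e : OpenPartialHomeomorph B (Fin n → ℝ)}
    (he : e ∈ (specialIntegralAffineGroupoid n).maximalAtlas B) (hy : (f y).proj ∈ e.source) :
    ContinuousAt f y ↔ ContinuousAt (fun z => (f z).proj) y ∧
      ContinuousAt (fun z => coord e (f z).proj (f z).2) y := by
  have hc := (specialIntegralAffineGroupoid n).chart_mem_maximalAtlas (f y).proj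
  have hyc := mem_chart_source (Fin n → ℝ) (f y).proj
  rw [FiberBundle.continuousAt_totalSpace]
  refine and_congr_right fun hp => ?_
  set c := chartAt (Fin n → ℝ) (f y).proj
  have h1 : (fun z => (trivializationAt (Covector n) (fun x : B => Cotangent n x)
      (f y).proj (f z)).2) =ᶠ[𝓝 y] fun z => coord c (f z).proj (f z).2 := by
    filter_upwards [hp.preimage_mem_nhds (c.open_source.mem_nhds hyc)] with z hz
    rw [trivializationAt_cotangent _ _ hz]
  rw [continuousAt_congr h1]
  have key : ∀ {d d' : OpenPartialHomeomorph B (Fin n → ℝ)},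
      d ∈ (specialIntegralAffineGroupoid n).maximalAtlas B →
      d' ∈ (specialIntegralAffineGroupoid n).maximalAtlas B → (f y).proj ∈ d.source →
      (f y).proj ∈ d'.source → ContinuousAt (fun z => coord d' (f z).proj (f z).2) y →
      ContinuousAt (fun z => coord d (f z).proj (f z).2) y := by
    intro d d' hd hd' hyd hyd' h
    obtain ⟨A, hA⟩ := exists_chartDeriv_eq hd hd' hyd hyd'
    have h2 : (fun z => coord d (f z).proj (f z).2) =ᶠ[𝓝 y]
        fun z => (coord d' (f z).proj (f z).2).comp (linearPart A) := by
      filter_upwards [hp.preimage_mem_nhds (d.open_source.mem_nhds hyd),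
        hp.preimage_mem_nhds (d'.open_source.mem_nhds hyd'), hp.eventually hA] with z hz hz' hzA
      exact coord_eq_comp hd hd' hz hz' hzA _
    rw [continuousAt_congr h2]
    exact h.clm_comp continuousAt_const
  exact ⟨key he hc hy hyc, key hc he hyc hy⟩

end

section

/-! ### The quotient map `T*B → X` is a covering map -/

/-- The quotient of `U × E` by the translations of `E` by a discrete subgroup is a covering. -/
theorem isCoveringMap_of_discrete_translations {U E X : Type*} [TopologicalSpace U]
    [AddCommGroup E] [TopologicalSpace E] [IsTopologicalAddGroup E] [TopologicalSpace X]
    (Γ : AddSubgroup E) (hΓ : ∃ V ∈ 𝓝 (0 : E), ∀ g ∈ Γ, g ∈ V → g = 0) {f : U × E → X}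
    (hf : IsQuotientMap f)
    (h : ∀ u u' a a', f (u, a) = f (u', a') ↔ u = u' ∧ a - a' ∈ Γ) : IsCoveringMap f := by
  let _ : AddAction Γ (U × E) :=
    { vadd := fun g p => (p.1, (g : E) + p.2)
      zero_vadd := fun p => Prod.ext rfl (zero_add _)
      add_vadd := fun g g' p => Prod.ext rfl (add_assoc _ _ _) }
  have hv (g : Γ) (p : U × E) : g +ᵥ p = (p.1, (g : E) + p.2) := rfl
  have key : IsAddQuotientCoveringMap f Γ :=
    { hf with
      continuous_const_vadd := fun g => by
        simp only [hv]
        fun_prop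
      apply_eq_iff_mem_orbit := by
        rintro ⟨u, a⟩ ⟨u', a'⟩
        rw [h]
        constructor
        · rintro ⟨rfl, ha⟩
          exact ⟨⟨_, ha⟩, by simp [hv]⟩
        · rintro ⟨g, hg⟩
          simp only [hv, Prod.mk.injEq] at hg
          refine ⟨hg.1.symm, ?_⟩
          rw [← hg.2, add_sub_cancel_right]
          exact g.2
      disjoint := by
        rintro ⟨u, a⟩
        obtain ⟨V, hV, hVΓ⟩ := hΓ
        have hc : ContinuousAt (fun p : E × E => p.1 - p.2) (a, a) := by fun_prop
        have hV' : (fun p : E × E => p.1 - p.2) ⁻¹' V ∈ 𝓝 a ×ˢ 𝓝 a := by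
          rw [← nhds_prod_eq]
          exact hc.preimage_mem_nhds (by simpa using hV)
        -- `W` is a neighbourhood of `a` with `W - W ⊆ V`, so a translate of `W` by `g ∈ Γ` that
        -- meets `W` has `g ∈ V`, hence `g = 0`.
        obtain ⟨W, hW, hWV⟩ := Filter.mem_prod_same_iff.1 hV'
        refine ⟨Prod.snd ⁻¹' W, continuous_snd.continuousAt.preimage_mem_nhds hW, ?_⟩
        rintro g ⟨_, ⟨p, hp, rfl⟩, hgp⟩
        have := hWV (a := ((g : E) + p.2, p.2)) ⟨hgp, hp⟩
        exact Subtype.ext (hVΓ g g.2 (by simpa using this)) }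
  exact key.isCoveringMap

/-- The values on the standard basis are integers, so they vanish as soon as they are less than 1 in
absolute value. -/
theorem exists_nhds_integralCovectors (n : ℕ) :
    ∃ V ∈ 𝓝 (0 : Covector n), ∀ g ∈ integralCovectors n, g ∈ V → g = 0 := by
  refine ⟨⋂ j : Fin n, {l | |l (Pi.single j 1)| < 1}, ?_, ?_⟩
  · refine Filter.iInter_mem.2 fun j => ?_
    have hc : Continuous fun l : Covector n => |l (Pi.single j 1)| := by fun_prop
    exact (isOpen_lt hc continuous_const).mem_nhds (by simp)
  · rintro g ⟨m, hm⟩ hg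
    have hm0 (j : Fin n) : m j = 0 := by
      have h := mem_iInter.1 hg j
      simp only [mem_ofPred_eq, hm] at h
      simp only [Pi.single_apply, mul_ite, mul_one, mul_zero, Finset.sum_ite_eq',
        Finset.mem_univ, if_true] at h
      exact Int.abs_lt_one_iff.1 (by exact_mod_cast h)
    ext1 v
    simp [hm, hm0]

variable {n : ℕ} {B : Type*} [TopologicalSpace B] [ChartedSpace (Fin n → ℝ) B]

/-- The quotient map `T*B → X`. -/
def toDualFibration (a : CotangentBundle n B) : DualFibration n B := DualFibration.mk a.proj a.2

theorem proj_toDualFibration (a : CotangentBundle n B) : (toDualFibration a).proj = a.proj := rfl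

theorem DualFibration.mk_eq_mk_iff {x : B} {a b : Cotangent n x} :
    DualFibration.mk x a = DualFibration.mk x b ↔ a - b ∈ dualLattice n x := by
  refine Quotient.eq.trans ⟨?_, fun h => ⟨b - a, by simpa using neg_mem h, by simp⟩⟩
  rintro ⟨l, hl, h⟩
  have : b = a + l := by simpa using h
  rw [this, sub_add_cancel_left]
  exact neg_mem hl

variable [HasGroupoid B (specialIntegralAffineGroupoid n)]

theorem isQuotientMap_toDualFibration :
    IsQuotientMap (toDualFibration : CotangentBundle n B → DualFibration n B) :=
  isQuotientMap_quotient_mk'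

theorem DualFibration.continuous_proj :
    Continuous (DualFibration.proj : DualFibration n B → B) :=
  isQuotientMap_toDualFibration.continuous_iff.2 (FiberBundle.continuous_proj _ _)

/-- The cotangent bundle over the domain of a chart is trivialized by the chart. -/
def chartFrame {e : OpenPartialHomeomorph B (Fin n → ℝ)}
    (he : e ∈ (specialIntegralAffineGroupoid n).maximalAtlas B) :
    e.source × Covector n ≃ₜ
      (toDualFibration ⁻¹' (DualFibration.proj ⁻¹' e.source) : Set (CotangentBundle n B)) where
  toFun p := ⟨⟨p.1, ofCoord e p.1 p.2⟩, p.1.2⟩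
  invFun a := ⟨⟨a.1.proj, a.2⟩, coord e a.1.proj a.1.2⟩
  left_inv p := Prod.ext rfl (coord_ofCoord he p.1.2 p.2)
  right_inv a := by
    refine Subtype.ext ?_
    change (⟨a.1.proj, ofCoord e a.1.proj (coord e a.1.proj a.1.2)⟩ : CotangentBundle n B) = a.1
    rw [ofCoord_coord he (x := a.1.proj) a.2]
  continuous_toFun := by
    refine Continuous.subtype_mk (continuous_iff_continuousAt.2 fun p => ?_) _
    rw [continuousAt_cotangent_iff he p.1.2]
    refine ⟨by fun_prop, ?_⟩
    have h : (fun p : e.source × Covector n => coord e p.1 (ofCoord e p.1 p.2)) = Prod.snd :=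
      funext fun p => coord_ofCoord he p.1.2 p.2
    change ContinuousAt (fun p : e.source × Covector n => coord e p.1 (ofCoord e p.1 p.2)) p
    rw [h]
    fun_prop
  continuous_invFun := by
    refine Continuous.prodMk (Continuous.subtype_mk
      ((FiberBundle.continuous_proj _ _).comp continuous_subtype_val) _) ?_
    refine continuous_iff_continuousAt.2 fun a => ?_
    exact ((continuousAt_cotangent_iff (f := Subtype.val) he a.2).1
      continuous_subtype_val.continuousAt).2

/-- The claim is local on `B`. Over a chart domain `U` the frame turns `T*B` into `U × (ℝⁿ)*` and
`Λ*` into the constant lattice of integral covectors, which acts by discrete translations. -/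
theorem isCoveringMap_toDualFibration :
    IsCoveringMap (toDualFibration : CotangentBundle n B → DualFibration n B) := by
  intro q
  have he := (specialIntegralAffineGroupoid n).chart_mem_maximalAtlas q.proj
  set e := chartAt (Fin n → ℝ) q.proj
  have hU : IsOpen (DualFibration.proj ⁻¹' e.source : Set (DualFibration n B)) :=
    e.open_source.preimage DualFibration.continuous_proj
  refine IsCoveringMapOn.of_isCoveringMap_restrictPreimage _ hU
    (hU.preimage isQuotientMap_toDualFibration.continuous) ?_ q
    (mem_chart_source (Fin n → ℝ) q.proj)
  rw [← IsCoveringMap.comp_homeomorph_iff (chartFrame he)]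
  refine isCoveringMap_of_discrete_translations (integralCovectors n)
    (exists_nhds_integralCovectors n)
    ((isQuotientMap_toDualFibration.restrictPreimage_isOpen hU).comp
      (chartFrame he).isQuotientMap) ?_
  intro u u' a a'
  have h : ∀ {u u' : e.source} {a a' : Covector n},
      (restrictPreimage (DualFibration.proj ⁻¹' e.source) toDualFibration ∘ chartFrame he) (u, a) =
      (restrictPreimage (DualFibration.proj ⁻¹' e.source) toDualFibration ∘ chartFrame he) (u', a')
      ↔ DualFibration.mk u.1 (ofCoord e u.1 a) = DualFibration.mk u'.1 (ofCoord e u'.1 a') :=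
    Subtype.ext_iff
  rw [h]
  constructor
  · intro h
    have hu : u = u' := Subtype.ext (congrArg DualFibration.proj h)
    subst hu
    rw [DualFibration.mk_eq_mk_iff, mem_dualLattice_iff he u.2, map_sub, coord_ofCoord he u.2,
      coord_ofCoord he u.2] at h
    exact ⟨rfl, h⟩
  · rintro ⟨rfl, h⟩
    rw [DualFibration.mk_eq_mk_iff, mem_dualLattice_iff he u.2, map_sub, coord_ofCoord he u.2,
      coord_ofCoord he u.2]
    exact h

end

section

/-! ### The path space as a subspace of the cotangent bundle -/

open unitInterval

variable {n : ℕ} {B : Type*} [TopologicalSpace B] [ChartedSpace (Fin n → ℝ) B]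

theorem mk_ofCoord_coord {e : OpenPartialHomeomorph B (Fin n → ℝ)}
    (he : e ∈ (specialIntegralAffineGroupoid n).maximalAtlas B) {x : B} (hx : x ∈ e.source)
    {a : CotangentBundle n B} (ha : a.proj = x) :
    DualFibration.mk x (ofCoord e x (coord e a.proj a.2)) = toDualFibration a := by
  subst ha
  rw [ofCoord_coord he hx]
  rfl

variable [HasGroupoid B (specialIntegralAffineGroupoid n)] {L : Set (DualFibration n B)}

/-- The evaluation of paths in the fibers of `X → B`. -/
def FiberPath.eval (L₁ L₂ : Set (DualFibration n B)) :
    C(I × FiberPath L₁ L₂, DualFibration n B) := ⟨fun p => p.2.1 p.1, by fun_prop⟩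

theorem FiberPath.proj_eq {L₁ L₂ : Set (DualFibration n B)} (γ : FiberPath L₁ L₂) (t : I) :
    (γ.1 t).proj = (γ.1 0).proj := by
  obtain ⟨x, hx⟩ := γ.2
  rw [hx.1 t, hx.1 0]

/-- The starting point in the zero section of `T*B` of the lift of a path. -/
def FiberPath.start (L : Set (DualFibration n B)) :
    C(FiberPath (zeroSection n B) L, CotangentBundle n B) :=
  ⟨fun γ => ⟨(γ.1 0).proj, 0⟩, (Bundle.Trivialization.continuous_zeroSection ℝ).comp
    (DualFibration.continuous_proj.comp (by fun_prop))⟩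

theorem FiberPath.eval_zero (γ : FiberPath (zeroSection n B) L) :
    FiberPath.eval _ _ (0, γ) = toDualFibration (FiberPath.start L γ) := by
  obtain ⟨x, hx⟩ := γ.2.choose_spec.2.1
  change γ.1 0 = DualFibration.mk (γ.1 0).proj 0
  rw [← hx]
  rfl

/-- The lift to `T*B` of paths starting on the zero section. -/
def FiberPath.lift (L : Set (DualFibration n B)) :
    C(I × FiberPath (zeroSection n B) L, CotangentBundle n B) :=
  isCoveringMap_toDualFibration.liftHomotopy (FiberPath.eval _ _) (FiberPath.start L)
    FiberPath.eval_zero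

theorem FiberPath.toDualFibration_lift (t : I) (γ : FiberPath (zeroSection n B) L) :
    toDualFibration (FiberPath.lift L (t, γ)) = γ.1 t :=
  congrFun (isCoveringMap_toDualFibration.liftHomotopy_lifts (FiberPath.eval _ _)
    (FiberPath.start L) FiberPath.eval_zero) (t, γ)

theorem FiberPath.lift_zero (γ : FiberPath (zeroSection n B) L) :
    FiberPath.lift L (0, γ) = ⟨(γ.1 0).proj, 0⟩ :=
  isCoveringMap_toDualFibration.liftHomotopy_zero (FiberPath.eval _ _)
    (FiberPath.start L) FiberPath.eval_zero γ

theorem FiberPath.proj_lift (t : I) (γ : FiberPath (zeroSection n B) L) :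
    (FiberPath.lift L (t, γ)).proj = (γ.1 0).proj := by
  rw [← proj_toDualFibration, FiberPath.toDualFibration_lift, γ.proj_eq]

/-- The endpoint of the lift to `T*B` of a path starting on the zero section. -/
def FiberPath.endpoint (γ : FiberPath (zeroSection n B) L) :
    {a : CotangentBundle n B // toDualFibration a ∈ L} :=
  ⟨FiberPath.lift L (1, γ), by
    rw [FiberPath.toDualFibration_lift]
    exact γ.2.choose_spec.2.2⟩

theorem FiberPath.continuous_endpoint :
    Continuous (FiberPath.endpoint : FiberPath (zeroSection n B) L → _) := by
  refine Continuous.subtype_mk ?_ _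
  fun_prop

/-- Along the homotopy the endpoint in `X` stays fixed, since `L` meets the fiber at most once. The
endpoint of the lift then moves continuously in a discrete fiber of the covering, so it is constant.
-/
theorem FiberPath.endpoint_eq (hL : InjOn DualFibration.proj L)
    {γ γ' : FiberPath (zeroSection n B) L} {x : B}
    (h : ContinuousMap.HomotopicWith γ.1 γ'.1 (IsFiberPath (zeroSection n B) L x)) :
    γ.endpoint = γ'.endpoint := by
  obtain ⟨h⟩ := h
  let δ : I → FiberPath (zeroSection n B) L := fun s => ⟨h.toHomotopy.curry s, x, h.prop' s⟩
  have hδ : Continuous δ := h.toHomotopy.curry.continuous.subtype_mk _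
  have h0 : δ 0 = γ := Subtype.ext (ContinuousMap.ext fun t => h.map_zero_left t)
  have h1 : δ 1 = γ' := Subtype.ext (ContinuousMap.ext fun t => h.map_one_left t)
  rw [← h0, ← h1]
  refine Subtype.ext (isCoveringMap_toDualFibration.const_of_comp
    (g := fun s => ((δ s).endpoint : CotangentBundle n B))
    (continuous_subtype_val.comp (FiberPath.continuous_endpoint.comp hδ)) (fun s s' => ?_) 0 1)
  refine hL (δ s).endpoint.2 (δ s').endpoint.2 ?_
  have hp (s : I) : (toDualFibration ((δ s).endpoint : CotangentBundle n B)).proj = x := by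
    change (toDualFibration (FiberPath.lift L (1, δ s))).proj = x
    rw [FiberPath.toDualFibration_lift]
    exact (h.prop' s).1 1
  rw [hp, hp]

theorem continuous_smul_cotangent :
    Continuous fun p : CotangentBundle n B × ℝ =>
      (⟨p.1.proj, p.2 • p.1.2⟩ : CotangentBundle n B) := by
  refine continuous_iff_continuousAt.2 fun p => ?_
  have he := (specialIntegralAffineGroupoid n).chart_mem_maximalAtlas p.1.proj
  have hx := mem_chart_source (Fin n → ℝ) p.1.proj
  have h := (continuousAt_cotangent_iff (f := Prod.fst) (y := p) he hx).1 continuousAt_fst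
  refine (continuousAt_cotangent_iff (f := fun p : CotangentBundle n B × ℝ =>
    (⟨p.1.proj, p.2 • p.1.2⟩ : CotangentBundle n B)) he hx).2 ⟨h.1, ?_⟩
  simp only [map_smul]
  exact continuousAt_snd.smul h.2

theorem continuous_mk_ofCoord {e : OpenPartialHomeomorph B (Fin n → ℝ)}
    (he : e ∈ (specialIntegralAffineGroupoid n).maximalAtlas B) {x : B} (hx : x ∈ e.source) :
    Continuous fun l : Covector n => DualFibration.mk x (ofCoord e x l) := by
  refine isQuotientMap_toDualFibration.continuous.comp
    (f := fun l : Covector n => (⟨x, ofCoord e x l⟩ : CotangentBundle n B)) ?_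
  refine continuous_iff_continuousAt.2 fun l => ?_
  rw [continuousAt_cotangent_iff he hx]
  refine ⟨continuousAt_const, ?_⟩
  simp only [coord_ofCoord he hx]
  exact continuousAt_id

/-- The geodesic `t ↦ [t a]` in a fiber of `X → B`, from the zero section to `[a]`. -/
def FiberPath.linear (a : {a : CotangentBundle n B // toDualFibration a ∈ L}) :
    FiberPath (zeroSection n B) L :=
  ⟨⟨fun t => DualFibration.mk a.1.proj ((t : ℝ) • a.1.2),
    isQuotientMap_toDualFibration.continuous.comp (continuous_smul_cotangent.comp
      (f := fun t : I => (a.1, (t : ℝ))) (by fun_prop))⟩,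
    a.1.proj, fun _ => rfl,
    ⟨a.1.proj, congrArg (DualFibration.mk a.1.proj) (zero_smul ℝ a.1.2).symm⟩,
    mem_of_eq_of_mem (congrArg (DualFibration.mk a.1.proj) (one_smul ℝ a.1.2)) a.2⟩

theorem FiberPath.linear_apply (a : {a : CotangentBundle n B // toDualFibration a ∈ L}) (t : I) :
    (FiberPath.linear a).1 t = DualFibration.mk a.1.proj ((t : ℝ) • a.1.2) := rfl

theorem FiberPath.continuous_linear :
    Continuous (FiberPath.linear : {a : CotangentBundle n B // toDualFibration a ∈ L} → _) := by
  refine Continuous.subtype_mk (ContinuousMap.continuous_of_continuous_uncurry _ ?_) _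
  exact isQuotientMap_toDualFibration.continuous.comp (continuous_smul_cotangent.comp
      (f := fun p : {a : CotangentBundle n B // toDualFibration a ∈ L} × I => (p.1.1, (p.2 : ℝ)))
      (by fun_prop))

/-- By uniqueness of lifts, `t ↦ t a` is the lift of its own projection. -/
theorem FiberPath.endpoint_linear (a : {a : CotangentBundle n B // toDualFibration a ∈ L}) :
    (FiberPath.linear a).endpoint = a := by
  have h := isCoveringMap_toDualFibration.eq_of_comp_eq
    (g₁ := fun t : I => FiberPath.lift L (t, FiberPath.linear a))
    (g₂ := fun t : I => (⟨a.1.proj, (t : ℝ) • a.1.2⟩ : CotangentBundle n B))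
    (by fun_prop) (continuous_smul_cotangent.comp
      (f := fun t : I => (a.1, (t : ℝ))) (by fun_prop))
    (funext fun t => FiberPath.toDualFibration_lift t _) 0
    ((FiberPath.lift_zero _).trans
      (congrArg (TotalSpace.mk a.1.proj) (zero_smul ℝ a.1.2).symm))
  refine Subtype.ext ((congrFun h 1).trans ?_)
  simp

theorem FiberPath.homotopic_linear (γ : FiberPath (zeroSection n B) L) :
    ContinuousMap.HomotopicWith γ.1 (FiberPath.linear γ.endpoint).1
      (IsFiberPath (zeroSection n B) L (γ.1 0).proj) := by
  have he := (specialIntegralAffineGroupoid n).chart_mem_maximalAtlas (γ.1 0).proj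
  have hx := mem_chart_source (Fin n → ℝ) (γ.1 0).proj
  set x := (γ.1 0).proj
  set e := chartAt (Fin n → ℝ) x
  have hp (t : I) : (FiberPath.lift L (t, γ)).proj = x := FiberPath.proj_lift t γ
  let c : I → Covector n := fun t =>
    coord e (FiberPath.lift L (t, γ)).proj (FiberPath.lift L (t, γ)).2
  have hc : Continuous c := continuous_iff_continuousAt.2 fun t =>
    ((continuousAt_cotangent_iff (f := fun t : I => FiberPath.lift L (t, γ)) he
      (by rw [hp]; exact hx)).1 (by fun_prop)).2
  have hc0 : c 0 = 0 := by
    simp only [c]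
    rw [FiberPath.lift_zero]
    exact map_zero _
  have hcγ (t : I) : DualFibration.mk x (ofCoord e x (c t)) = γ.1 t := by
    rw [mk_ofCoord_coord he hx (hp t), FiberPath.toDualFibration_lift]
  have h1 (t : I) : DualFibration.mk x (ofCoord e x ((t : ℝ) • c 1)) =
      (FiberPath.linear γ.endpoint).1 t := by
    have := mk_ofCoord_coord he hx
      (a := ⟨γ.endpoint.1.proj, (t : ℝ) • γ.endpoint.1.2⟩) (hp 1)
    rw [map_smul] at this
    exact this
  -- Straight-line homotopy in the vector space `T*_x B` from the lift `c` to the segment `t ↦ t • c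
  -- 1`. Both start at `0` and end at `c 1`, so the endpoints never move and remain in `L₀` and `L`.
  refine ⟨{
    toFun := fun p => DualFibration.mk x
      (ofCoord e x ((1 - (p.1 : ℝ)) • c p.2 + ((p.1 : ℝ) * (p.2 : ℝ)) • c 1))
    continuous_toFun := (continuous_mk_ofCoord he hx).comp (by fun_prop)
    map_zero_left := fun t => by simp [hcγ]
    map_one_left := fun t => by simp [h1]
    prop' := fun s => by
      refine ⟨fun t => rfl, ⟨x, ?_⟩, ?_⟩
      · simp only [ContinuousMap.coe_mk, hc0]
        simp [ofCoord]
      · have h : (1 - (s : ℝ)) • c 1 + ((s : ℝ) * ((1 : I) : ℝ)) • c 1 = c 1 := by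
          rw [← add_smul]; simp
        simp only [ContinuousMap.coe_mk, h, hcγ]
        exact γ.2.choose_spec.2.2 }⟩

/-- If `L` meets every fiber of `X → B` at most once, the space `P(L₀, L)` is homeomorphic to the
preimage of `L` in `T*B`, by lifting paths to `T*B` and taking the endpoint. -/
def PathSpace.homeomorph (hL : InjOn DualFibration.proj L) :
    PathSpace (zeroSection n B) L ≃ₜ {a : CotangentBundle n B // toDualFibration a ∈ L} where
  toFun := Quotient.lift FiberPath.endpoint fun _ _ h => FiberPath.endpoint_eq hL h.choose_spec
  invFun a := PathSpace.mk (FiberPath.linear a)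
  left_inv := by
    rintro ⟨γ⟩
    exact (Quotient.sound (s := fiberHomotopySetoid (zeroSection n B) L) (a := γ)
      (b := FiberPath.linear γ.endpoint) ⟨_, FiberPath.homotopic_linear γ⟩).symm
  right_inv := FiberPath.endpoint_linear
  continuous_toFun := FiberPath.continuous_endpoint.quotient_lift _
  continuous_invFun := continuous_quotient_mk'.comp FiberPath.continuous_linear

theorem PathSpace.proj_homeomorph (hL : InjOn DualFibration.proj L)
    (c : PathSpace (zeroSection n B) L) : (PathSpace.homeomorph hL c).1.proj = c.proj := by
  obtain ⟨γ⟩ := c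
  exact FiberPath.proj_lift 1 γ

theorem PathSpace.homeomorph_ofPoint (hL : InjOn DualFibration.proj L)
    (p : ↥(zeroSection n B ∩ L)) :
    (PathSpace.homeomorph hL (PathSpace.ofPoint p)).1 = ⟨p.1.proj, 0⟩ := by
  have hp : toDualFibration (⟨p.1.proj, 0⟩ : CotangentBundle n B) = p.1 := by
    obtain ⟨x, hx⟩ := p.2.1
    rw [← hx]
    rfl
  have h : PathSpace.ofPoint p = (PathSpace.homeomorph hL).symm ⟨⟨p.1.proj, 0⟩, hp ▸ p.2.2⟩ := by
    refine congrArg PathSpace.mk (Subtype.ext (ContinuousMap.ext fun t => ?_))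
    rw [FiberPath.linear_apply, smul_zero]
    exact hp.symm
  rw [h, Homeomorph.apply_symm_apply]

/-- `areaDifferential` is a chosen value, meaningful once some geodesic representative exists;
`FiberPath.linear` supplies one. If the chosen velocity is zero, the representative that comes with
it is a constant path. No uniqueness of the velocity is needed. -/
theorem PathSpace.IsCritical.exists_eq_ofPoint (hL : InjOn DualFibration.proj L)
    {c : PathSpace (zeroSection n B) L} (hc : c.IsCritical) :
    ∃ p : ↥(zeroSection n B ∩ L), c = PathSpace.ofPoint p := by
  have hex : ∃ α : Cotangent n c.proj, ∃ (γ : FiberPath (zeroSection n B) L)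
      (β : Cotangent n c.proj), mk γ = c ∧
      ∀ t : unitInterval, γ.1 t = DualFibration.mk c.proj (β + (t : ℝ) • α) := by
    obtain ⟨a, rfl⟩ := (PathSpace.homeomorph hL).symm.surjective c
    exact ⟨a.1.2, FiberPath.linear a, 0, rfl, fun t => by rw [zero_add]; rfl⟩
  obtain ⟨γ, β, hγ, hβ⟩ := Classical.epsilon_spec hex
  have hβ' (t : I) : γ.1 t = DualFibration.mk c.proj β := by
    have h := hβ t
    rwa [show Classical.epsilon _ = (0 : Cotangent n c.proj) from hc, smul_zero, add_zero] at h
  have h0 : DualFibration.mk c.proj β ∈ zeroSection n B := hβ' 0 ▸ γ.2.choose_spec.2.1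
  have h1 : DualFibration.mk c.proj β ∈ L := hβ' 1 ▸ γ.2.choose_spec.2.2
  refine ⟨⟨_, h0, h1⟩, hγ.symm.trans ?_⟩
  exact congrArg PathSpace.mk (Subtype.ext (ContinuousMap.ext hβ'))

end

section

variable {n : ℕ} {B : Type*} [TopologicalSpace B] [ChartedSpace (Fin n → ℝ) B]

/-! ### The path space of a section is a covering space of the base -/

theorem injOn_proj_of_section {L : Set (DualFibration n B)} {s : B → DualFibration n B}
    (hps : ∀ x, (s x).proj = x) (hL : L = range s) : InjOn DualFibration.proj L := by
  subst hL
  rintro _ ⟨x, rfl⟩ _ ⟨y, rfl⟩ h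
  rw [hps, hps] at h
  rw [h]

variable [HasGroupoid B (specialIntegralAffineGroupoid n)]

/-- The image of a continuous section of `X → B` is homeomorphic to `B`. -/
def homeomorphOfSection {s : B → DualFibration n B} (hs : Continuous s)
    (hps : ∀ x, (s x).proj = x) : range s ≃ₜ B where
  toFun a := a.1.proj
  invFun x := ⟨s x, x, rfl⟩
  left_inv := by
    rintro ⟨_, x, rfl⟩
    exact Subtype.ext (congrArg s (hps x))
  right_inv := hps
  continuous_toFun := DualFibration.continuous_proj.comp continuous_subtype_val
  continuous_invFun := hs.subtype_mk _

/-- Restrict the covering `T*B → X` to the part over `L`, then identify `L` with `B` by the section.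
-/
theorem PathSpace.isCoveringMap_proj {L : Set (DualFibration n B)} {s : B → DualFibration n B}
    (hs : Continuous s) (hps : ∀ x, (s x).proj = x) (hL : L = range s) :
    IsCoveringMap (PathSpace.proj : PathSpace (zeroSection n B) L → B) := by
  subst hL
  have hinj := injOn_proj_of_section hps rfl
  let H : PathSpace (zeroSection n B) (range s) ≃ₜ
      (toDualFibration ⁻¹' range s : Set (CotangentBundle n B)) := PathSpace.homeomorph hinj
  have h := ((isCoveringMap_toDualFibration.restrictPreimage (range s)).homeomorph_comp
    (homeomorphOfSection hs hps)).comp_homeomorph H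
  have h' : (homeomorphOfSection hs hps ∘ (range s).restrictPreimage toDualFibration) ∘ H =
      PathSpace.proj :=
    funext fun c => PathSpace.proj_homeomorph hinj c
  rwa [h'] at h

/-! ### The Lagrangian section of a system of potentials -/

namespace IntegralPotentials

variable {g : Metric n B} (Φ : IntegralPotentials g)

theorem contDiffAt {i : Φ.ι} {x : B} (hx : x ∈ (Φ.chart i).source) :
    ContDiffAt ℝ ∞ (Φ.φ i) (Φ.chart i x) :=
  (Φ.smooth i).contDiffAt ((Φ.chart i).open_target.mem_nhds ((Φ.chart i).map_source hx))

theorem differentiableAt {i : Φ.ι} {x : B} (hx : x ∈ (Φ.chart i).source) :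
    DifferentiableAt ℝ (Φ.φ i) (Φ.chart i x) :=
  (Φ.contDiffAt hx).differentiableAt (by simp)

theorem differentiableAt_fderiv {i : Φ.ι} {x : B} (hx : x ∈ (Φ.chart i).source) :
    DifferentiableAt ℝ (fderiv ℝ (Φ.φ i)) (Φ.chart i x) :=
  ((Φ.contDiffAt hx).fderiv_right (m := 1) (WithTop.coe_le_coe.2 le_top)).differentiableAt (by simp)

/-- The differential at `x` of a potential. -/
def dpot (i : Φ.ι) (x : B) : Cotangent n x := differential (fun y => Φ.φ i (Φ.chart i y)) x

theorem coord_dpot {i : Φ.ι} {x : B} (hx : x ∈ (Φ.chart i).source) :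
    coord (Φ.chart i) x (Φ.dpot i x) = fderiv ℝ (Φ.φ i) (Φ.chart i x) := by
  rw [dpot, differential_comp_chart (Φ.chart_mem i) hx (Φ.differentiableAt hx),
    coord_ofCoord (Φ.chart_mem i) hx]

/-- The integrality of the overlaps enters here: the two differentials differ by `∑ m_k dx^k`, an
element of `Λ*`. -/
theorem mk_dpot_eq {i j : Φ.ι} {x : B} (hi : x ∈ (Φ.chart i).source)
    (hj : x ∈ (Φ.chart j).source) :
    DualFibration.mk x (Φ.dpot i x) = DualFibration.mk x (Φ.dpot j x) := by
  obtain ⟨m, a, hma⟩ := Φ.integral i j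
  let l : Covector n := ∑ k, (m k : ℝ) • ContinuousLinearMap.proj (R := ℝ) k
  have hl (v : Fin n → ℝ) : l v = ∑ k, (m k : ℝ) * v k := by simp [l]
  have hd : HasFDerivAt (fun v => Φ.φ j v + (l v + a))
      (fderiv ℝ (Φ.φ j) (Φ.chart j x) + l) (Φ.chart j x) :=
    (Φ.differentiableAt hj).hasFDerivAt.add (l.hasFDerivAt.add_const a)
  have h : Φ.dpot i x = differential (fun y => Φ.φ j (Φ.chart j y) + (l (Φ.chart j y) + a)) x := by
    refine Filter.EventuallyEq.mfderiv_eq ?_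
    filter_upwards [(Φ.chart i).open_source.mem_nhds hi, (Φ.chart j).open_source.mem_nhds hj]
      with y hyi hyj
    rw [hl, ← hma y ⟨hyi, hyj⟩]
    ring
  rw [DualFibration.mk_eq_mk_iff, mem_dualLattice_iff (Φ.chart_mem j) hj, map_sub,
    Φ.coord_dpot hj, h, differential_comp_chart (Φ.chart_mem j) hj hd.differentiableAt,
    coord_ofCoord (Φ.chart_mem j) hj, hd.fderiv, add_sub_cancel_left]
  exact ⟨m, hl⟩

/-- The section `x ↦ [dφ(x)]` of `X → B`. -/
def lagrangianSection (x : B) : DualFibration n B :=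
  DualFibration.mk x (Φ.dpot (Φ.cover x).choose x)

theorem lagrangianSection_eq {i : Φ.ι} {x : B} (hx : x ∈ (Φ.chart i).source) :
    Φ.lagrangianSection x = DualFibration.mk x (Φ.dpot i x) :=
  Φ.mk_dpot_eq (Φ.cover x).choose_spec hx

theorem proj_lagrangianSection (x : B) : (Φ.lagrangianSection x).proj = x := rfl

theorem lagrangian_eq_range : Φ.lagrangian = range Φ.lagrangianSection := by
  ext a
  constructor
  · rintro ⟨i, x, hx, rfl⟩
    exact ⟨x, Φ.lagrangianSection_eq hx⟩
  · rintro ⟨x, rfl⟩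
    exact ⟨_, x, (Φ.cover x).choose_spec, rfl⟩

theorem continuous_lagrangianSection : Continuous Φ.lagrangianSection := by
  refine continuous_iff_continuousAt.2 fun x => ?_
  obtain ⟨i, hi⟩ := Φ.cover x
  have hnear := (Φ.chart i).open_source.mem_nhds hi
  have h : ContinuousAt (fun y => (⟨y, Φ.dpot i y⟩ : CotangentBundle n B)) x := by
    rw [continuousAt_cotangent_iff (Φ.chart_mem i) hi]
    refine ⟨continuousAt_id, ?_⟩
    have h1 : (fun y => coord (Φ.chart i) y (Φ.dpot i y)) =ᶠ[𝓝 x]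
        fun y => fderiv ℝ (Φ.φ i) (Φ.chart i y) := by
      filter_upwards [hnear] with y hy using Φ.coord_dpot hy
    refine ContinuousAt.congr ?_ h1.symm
    exact (Φ.differentiableAt_fderiv hi).continuousAt.comp ((Φ.chart i).continuousAt hi)
  refine (isQuotientMap_toDualFibration.continuous.continuousAt.comp h).congr ?_
  filter_upwards [hnear] with y hy using (Φ.lagrangianSection_eq hy).symm

theorem injOn_proj_lagrangian : InjOn DualFibration.proj Φ.lagrangian :=
  injOn_proj_of_section Φ.proj_lagrangianSection Φ.lagrangian_eq_range

theorem isCoveringMap_proj :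
    IsCoveringMap (PathSpace.proj : PathSpace (zeroSection n B) Φ.lagrangian → B) :=
  PathSpace.isCoveringMap_proj Φ.continuous_lagrangianSection Φ.proj_lagrangianSection
    Φ.lagrangian_eq_range

end IntegralPotentials

end

section

/-! ### Sheets of a covering over a simply connected covering -/

section Sheets

variable {V Y B : Type*} [TopologicalSpace V] [TopologicalSpace Y] [TopologicalSpace B]
  {q : V → B} {r : Y → B}

/-- Through every point of a covering space of `B` there is a lift of a map from a simply
connected space. -/
theorem exists_lift_through [SimplyConnectedSpace V] [LocallyPathConnectedSpace V]
    (hq : Continuous q) (hr : IsCoveringMap r) {v : V} {c : Y} (h : q v = r c) :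
    ∃ σ : V → Y, Continuous σ ∧ (∀ w, r (σ w) = q w) ∧ σ v = c := by
  obtain ⟨F, ⟨hF, hF'⟩, -⟩ :=
    hr.existsUnique_continuousMap_lifts ⟨q, hq⟩ v c h.symm
  exact ⟨F, F.continuous, fun w => congrFun hF' w, hF⟩

/-- Both `r` and `r ∘ σ = q` are local homeomorphisms, hence so is `σ`. -/
theorem isOpenMap_of_lift (hq : IsCoveringMap q) (hr : IsCoveringMap r) {σ : V → Y}
    (hσ : Continuous σ) (hσq : ∀ w, r (σ w) = q w) : IsOpenMap σ := by
  have h : IsLocalHomeomorph (r ∘ σ) := by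
    rw [show r ∘ σ = q from funext hσq]
    exact hq.isLocalHomeomorph
  exact (h.of_comp hr.isLocalHomeomorph hσ).isOpenMap

/-- Two lifts of `q` with a common value are related by lifting paths through `q`. -/
theorem exists_path_of_lift_eq [PathConnectedSpace V] (hq : IsCoveringMap q)
    (hr : IsCoveringMap r) {σ σ' : V → Y} (hσ : Continuous σ) (hσq : ∀ w, r (σ w) = q w)
    (hσ' : Continuous σ') (hσq' : ∀ w, r (σ' w) = q w) {w w' : V} (h : σ w = σ' w') (u' : V) :
    ∃ p p' : C(unitInterval, V), p 0 = w ∧ p' 0 = w' ∧ p' 1 = u' ∧ (∀ t, q (p t) = q (p' t)) ∧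
      σ (p 1) = σ' u' := by
  -- `p'` joins `w'` to `u'`, and `p` lifts `q ∘ p'` through `q` starting at `w`. Then `σ ∘ p` and
  -- `σ' ∘ p'` lift the same path through `r` and agree at time 0, hence also at time 1.
  obtain ⟨p'⟩ := PathConnectedSpace.joined w' u'
  have h0 : q (p' 0) = q w := by
    rw [p'.source, ← hσq', ← h, hσq]
  obtain ⟨p, hp, hp0⟩ := hq.exists_path_lifts ((⟨q, hq.continuous⟩ : C(V, B)).comp p'.1) w h0
  refine ⟨p, p'.1, hp0, p'.source, p'.target, fun t => congrFun hp t, ?_⟩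
  have h1 := hr.eq_of_comp_eq (g₁ := fun t => σ (p t)) (g₂ := fun t => σ' (p' t))
    (by fun_prop) (by fun_prop)
    (funext fun t => by simpa [hσq, hσq'] using congrFun hp t) 0 (by simp [hp0, h])
  simpa using congrFun h1 1

theorem range_subset_of_lift_eq [PathConnectedSpace V] (hq : IsCoveringMap q)
    (hr : IsCoveringMap r) {σ σ' : V → Y} (hσ : Continuous σ) (hσq : ∀ w, r (σ w) = q w)
    (hσ' : Continuous σ') (hσq' : ∀ w, r (σ' w) = q w) {w w' : V} (h : σ w = σ' w') :
    range σ' ⊆ range σ := by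
  rintro _ ⟨u', rfl⟩
  obtain ⟨p, -, -, -, -, -, h1⟩ := exists_path_of_lift_eq hq hr hσ hσq hσ' hσq' h u'
  exact ⟨p 1, h1⟩

/-- A lift of `q` taking some value exactly once is injective. -/
theorem injective_of_lift [PathConnectedSpace V] (hq : IsCoveringMap q) (hr : IsCoveringMap r)
    {σ : V → Y} (hσ : Continuous σ) (hσq : ∀ w, r (σ w) = q w) {v : V}
    (hv : ∀ w, σ w = σ v → w = v) : Function.Injective σ := by
  intro w w' h
  -- Transport the coincidence to `v`: there `σ (p 1) = σ v` forces `p 1 = v = p' 1`. The paths `p`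
  -- and `p'` lift the same path through `q`, so they agree at time 0 too.
  obtain ⟨p, p', hp0, hp0', hp1', hpq, h1⟩ := exists_path_of_lift_eq hq hr hσ hσq hσ hσq h v
  have h2 := hq.eq_of_comp_eq p.continuous p'.continuous (funext hpq) 1
    ((hv _ h1).trans hp1'.symm)
  rw [← hp0, ← hp0', h2]

theorem isOpen_connectedComponent_of_covering [SimplyConnectedSpace V]
    [LocallyPathConnectedSpace V] (hq : IsCoveringMap q) (hq' : Function.Surjective q)
    (hr : IsCoveringMap r) (c : Y) : IsOpen (connectedComponent c) := by
  refine isOpen_iff_mem_nhds.2 fun c' hc' => ?_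
  obtain ⟨v, hv⟩ := hq' (r c')
  obtain ⟨σ, hσ, hσq, hσv⟩ := exists_lift_through hq.continuous hr hv
  refine Filter.mem_of_superset
    ((isOpenMap_of_lift hq hr hσ hσq).isOpen_range.mem_nhds ⟨v, hσv⟩) ?_
  rw [connectedComponent_eq hc']
  exact (isPreconnected_range hσ).subset_connectedComponent ⟨v, hσv⟩

/-- The range is connected and open. It is also closed: through a point outside it passes another
lift, whose open range cannot meet the first one, because lifts with a common value have comparable
ranges. -/
theorem connectedComponent_eq_range [SimplyConnectedSpace V] [LocallyPathConnectedSpace V]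
    (hq : IsCoveringMap q) (hq' : Function.Surjective q) (hr : IsCoveringMap r) {σ : V → Y}
    (hσ : Continuous σ) (hσq : ∀ w, r (σ w) = q w) (v : V) :
    connectedComponent (σ v) = range σ := by
  refine Subset.antisymm ?_
    ((isPreconnected_range hσ).subset_connectedComponent ⟨v, rfl⟩)
  refine IsClopen.connectedComponent_subset ⟨isOpen_compl_iff.1 ?_,
    (isOpenMap_of_lift hq hr hσ hσq).isOpen_range⟩ ⟨v, rfl⟩
  refine isOpen_iff_mem_nhds.2 fun c hc => ?_
  obtain ⟨w', hw'⟩ := hq' (r c)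
  obtain ⟨σ', hσ', hσq', rfl⟩ := exists_lift_through hq.continuous hr hw'
  refine Filter.mem_of_superset
    ((isOpenMap_of_lift hq hr hσ' hσq').isOpen_range.mem_nhds ⟨w', rfl⟩) ?_
  rintro _ ⟨u', rfl⟩ ⟨u, hu⟩
  exact hc (range_subset_of_lift_eq hq hr hσ hσq hσ' hσq' hu ⟨w', rfl⟩)

/-- If a lift of `q` takes some value exactly once, it is a homeomorphism onto a component. -/
theorem exists_homeomorph_connectedComponent [SimplyConnectedSpace V]
    [LocallyPathConnectedSpace V] (hq : IsCoveringMap q) (hq' : Function.Surjective q)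
    (hr : IsCoveringMap r) {σ : V → Y} (hσ : Continuous σ) (hσq : ∀ w, r (σ w) = q w) {v : V}
    (hv : ∀ w, σ w = σ v → w = v) :
    ∃ h : V ≃ₜ connectedComponent (σ v), ∀ w, r (h w) = q w := by
  have hemb : IsOpenEmbedding σ := IsOpenEmbedding.of_continuous_injective_isOpenMap hσ
    (injective_of_lift hq hr hσ hσq hv) (isOpenMap_of_lift hq hr hσ hσq)
  exact ⟨hemb.isEmbedding.toHomeomorph.trans
    (Homeomorph.setCongr (connectedComponent_eq_range hq hq' hr hσ hσq v).symm), hσq⟩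

/-- A union of connected components which are all open is open and closed. -/
theorem isClopen_iUnion_connectedComponent (h : ∀ c : Y, IsOpen (connectedComponent c))
    {ι : Sort*} (c : ι → Y) : IsClopen (⋃ i, connectedComponent (c i)) := by
  refine ⟨isOpen_compl_iff.1 (isOpen_iff_mem_nhds.2 fun y hy => ?_),
    isOpen_iUnion fun i => h (c i)⟩
  refine Filter.mem_of_superset ((h y).mem_nhds mem_connectedComponent) fun z hz hz' => hy ?_
  obtain ⟨i, hi⟩ := mem_iUnion.1 hz'
  refine mem_iUnion.2 ⟨i, ?_⟩
  rw [connectedComponent_eq hi, ← connectedComponent_eq hz]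
  exact mem_connectedComponent

end Sheets

end

section

variable {n : ℕ} {B : Type*} [TopologicalSpace B] [ChartedSpace (Fin n → ℝ) B]
  [HasGroupoid B (specialIntegralAffineGroupoid n)]

/-! ### Zeros of lifts of the Lagrangian section -/

/-- The derivative at `w` of a map `ℝⁿ → B`. -/
def mapDeriv (q : (Fin n → ℝ) → B) (w : Fin n → ℝ) :
    (Fin n → ℝ) →L[ℝ] TangentSpace 𝓘(ℝ, Fin n → ℝ) (q w) :=
  mfderiv 𝓘(ℝ, Fin n → ℝ) 𝓘(ℝ, Fin n → ℝ) q w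

/-- The pullback of a covector along a map `ℝⁿ → B`. -/
def pullback (q : (Fin n → ℝ) → B) (w : Fin n → ℝ) (b : Cotangent n (q w)) : Covector n :=
  b.comp (mapDeriv q w)

/-- A local affine isomorphism is given by an affine map in any affine chart. -/
theorem IsLocalAffineIso.exists_affine {q : (Fin n → ℝ) → B} (hq : IsLocalAffineIso q)
    (hqc : Continuous q) {e : OpenPartialHomeomorph B (Fin n → ℝ)}
    (he : e ∈ (specialIntegralAffineGroupoid n).maximalAtlas B) {v : Fin n → ℝ}
    (hv : q v ∈ e.source) :
    ∃ (T : (Fin n → ℝ) →L[ℝ] (Fin n → ℝ)) (b : Fin n → ℝ), Function.Injective T ∧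
      ∀ᶠ w in 𝓝 v, q w ∈ e.source ∧ e (q w) = T w + b ∧
        ∀ u, chartDeriv e (q w) (mapDeriv q w u) = T u := by
  obtain ⟨A, hA⟩ := hq v
  have hc := (specialIntegralAffineGroupoid n).chart_mem_maximalAtlas (q v)
  obtain ⟨S, b, hS⟩ := exists_transition hc he (mem_chart_source (Fin n → ℝ) (q v)) hv
  let T : (Fin n → ℝ) →L[ℝ] (Fin n → ℝ) :=
    (linearPart S).comp (LinearMap.toContinuousLinearMap (A.linear : (Fin n → ℝ) →ₗ[ℝ] _))
  have hT : ∀ᶠ w in 𝓝 v, q w ∈ e.source ∧ e (q w) = T w + (linearPart S (A 0) + b) := by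
    filter_upwards [hA, hqc.continuousAt.eventually hS,
      hqc.continuousAt.preimage_mem_nhds (e.open_source.mem_nhds hv)] with w hw hSw hwe
    refine ⟨hwe, ?_⟩
    have hAw : A w = A.linear w + A 0 := by
      simpa using A.toAffineMap.map_vadd 0 w
    rw [hSw, hw.2, hAw, map_add, add_assoc]
    rfl
  refine ⟨T, linearPart S (A 0) + b, ?_, hT.eventually_nhds.mono fun w hw => ?_⟩
  · have hS : Function.Injective (linearPart S) := by
      refine Function.LeftInverse.injective (g := linearPart S⁻¹) fun v => ?_
      rw [← linearPart_mul, inv_mul_cancel, linearPart_one]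
    exact hS.comp A.linear.injective
  · have hw' := hw.self_of_nhds
    refine ⟨hw'.1, hw'.2, fun u => ?_⟩
    have hG : HasFDerivAt (fun z => T z + (linearPart S (A 0) + b)) T w :=
      T.hasFDerivAt.add_const _
    have he' := mdifferentiable_of_mem_maximalAtlas he
    have hqd : MDifferentiableAt 𝓘(ℝ, Fin n → ℝ) 𝓘(ℝ, Fin n → ℝ) q w := by
      have h1 : MDifferentiableAt 𝓘(ℝ, Fin n → ℝ) 𝓘(ℝ, Fin n → ℝ) e.symm
          (T w + (linearPart S (A 0) + b)) :=
        he'.mdifferentiableAt_symm (hw'.2 ▸ e.map_source hw'.1)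
      -- Differentiability of `q` is not assumed: near `w`, `q` is `e.symm` after an affine map.
      refine (h1.comp w hG.differentiableAt.mdifferentiableAt).congr_of_eventuallyEq ?_
      filter_upwards [hw] with z hz
      rw [Function.comp_apply, ← hz.2, e.left_inv hz.1]
    have h2 := ((he'.mdifferentiableAt hw'.1).hasMFDerivAt.comp w hqd.hasMFDerivAt).mfderiv
    have h3 := (hG.hasMFDerivAt.congr_of_eventuallyEq (hw.mono fun z hz => hz.2)).mfderiv
    exact congrArg (fun f => f u) (h2.symm.trans h3)

theorem hasDerivAt_apply_comp {E F G : Type*} [NormedAddCommGroup E] [NormedSpace ℝ E]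
    [NormedAddCommGroup F] [NormedSpace ℝ F] [NormedAddCommGroup G] [NormedSpace ℝ G]
    {f : E → F →L[ℝ] G} {c : ℝ → E} {c' : E} {t : ℝ} (hf : DifferentiableAt ℝ f (c t))
    (hc : HasDerivAt c c' t) (w : F) :
    HasDerivAt (fun s => f (c s) w) (fderiv ℝ f (c t) c' w) t :=
  (ContinuousLinearMap.apply ℝ G w).hasFDerivAt.comp_hasDerivAt t
    (hf.hasFDerivAt.comp_hasDerivAt t hc)

namespace IntegralPotentials

variable {g : Metric n B} (Φ : IntegralPotentials g)

/-- In a chart of the cover, a lift to `T*B` of the Lagrangian section along `q` is the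
differential of the potential up to a locally constant integral covector. -/
theorem exists_coord_eq {q : (Fin n → ℝ) → B} {β : ∀ w, Cotangent n (q w)}
    (hβ : Continuous fun w => (⟨q w, β w⟩ : CotangentBundle n B))
    (hβL : ∀ w, toDualFibration (⟨q w, β w⟩ : CotangentBundle n B) ∈ Φ.lagrangian)
    (hqc : Continuous q) {i : Φ.ι} {v : Fin n → ℝ} (hv : q v ∈ (Φ.chart i).source) :
    ∃ l : Covector n, ∀ᶠ w in 𝓝 v,
      coord (Φ.chart i) (q w) (β w) = fderiv ℝ (Φ.φ i) (Φ.chart i (q w)) + l := by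
  have hmem (w : Fin n → ℝ) (hw : q w ∈ (Φ.chart i).source) :
      coord (Φ.chart i) (q w) (β w) - fderiv ℝ (Φ.φ i) (Φ.chart i (q w)) ∈
        integralCovectors n := by
    have h : DualFibration.mk (q w) (β w) = DualFibration.mk (q w) (Φ.dpot i (q w)) := by
      refine Φ.injOn_proj_lagrangian (hβL w) ?_ rfl
      exact ⟨i, q w, hw, rfl⟩
    rwa [DualFibration.mk_eq_mk_iff, mem_dualLattice_iff (Φ.chart_mem i) hw, map_sub,
      Φ.coord_dpot hw] at h
  have hcont : ContinuousAt (fun w => coord (Φ.chart i) (q w) (β w) -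
      fderiv ℝ (Φ.φ i) (Φ.chart i (q w))) v := by
    refine ContinuousAt.sub ((continuousAt_cotangent_iff (Φ.chart_mem i)
      (f := fun w => (⟨q w, β w⟩ : CotangentBundle n B)) hv).1 hβ.continuousAt).2 ?_
    have h : ContinuousAt (fun w => Φ.chart i (q w)) v :=
      ((Φ.chart i).continuousAt hv).comp (f := q) hqc.continuousAt
    exact (Φ.differentiableAt_fderiv hv).continuousAt.comp (f := fun w => Φ.chart i (q w)) h
  -- The difference is continuous at `v` with values in a discrete group, hence constant near `v`.
  obtain ⟨W, hW, hWΓ⟩ := exists_nhds_integralCovectors n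
  refine ⟨coord (Φ.chart i) (q v) (β v) - fderiv ℝ (Φ.φ i) (Φ.chart i (q v)), ?_⟩
  have h2 := (hcont.sub (continuousAt_const (y := coord (Φ.chart i) (q v) (β v) -
    fderiv ℝ (Φ.φ i) (Φ.chart i (q v))))).preimage_mem_nhds (by simpa using hW)
  filter_upwards [h2,
    hqc.continuousAt.preimage_mem_nhds ((Φ.chart i).open_source.mem_nhds hv)] with w hwW hw
  have := hWΓ _ (sub_mem (hmem w hw) (hmem v hv)) hwW
  rw [← sub_eq_zero.1 this]
  abel

theorem hessian_pos {i : Φ.ι} {x : B} (hx : x ∈ (Φ.chart i).source) {u : Fin n → ℝ}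
    (hu : u ≠ 0) : 0 < fderiv ℝ (fderiv ℝ (Φ.φ i)) (Φ.chart i x) u u := by
  have h := Φ.hessian i x hx (chartDerivSymm (Φ.chart i) x u) (chartDerivSymm (Φ.chart i) x u)
  have h1 : mfderiv 𝓘(ℝ, Fin n → ℝ) 𝓘(ℝ, Fin n → ℝ) (Φ.chart i) x
      (chartDerivSymm (Φ.chart i) x u) = u := chartDeriv_chartDerivSymm (Φ.chart_mem i) hx u
  rw [h1] at h
  rw [← h]
  refine g.pos x _ fun h0 => hu ?_
  rw [h0] at h1
  exact h1.symm.trans (map_zero _)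

/-- On `ℝⁿ` the pulled back field is locally the differential of `w ↦ φ (T w + b) + l (T w)`, with
`T`, `b`, `l` fixed near `v`, so it can be differentiated along lines. -/
theorem exists_pullback_eq {q : (Fin n → ℝ) → B} (hq : IsLocalAffineIso q)
    {β : ∀ w, Cotangent n (q w)}
    (hβ : Continuous fun w => (⟨q w, β w⟩ : CotangentBundle n B))
    (hβL : ∀ w, toDualFibration (⟨q w, β w⟩ : CotangentBundle n B) ∈ Φ.lagrangian)
    (hqc : Continuous q) {i : Φ.ι} {v : Fin n → ℝ} (hv : q v ∈ (Φ.chart i).source) :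
    ∃ (T : (Fin n → ℝ) →L[ℝ] (Fin n → ℝ)) (b : Fin n → ℝ) (l : Covector n),
      Function.Injective T ∧ Φ.chart i (q v) = T v + b ∧ ∀ᶠ w in 𝓝 v, ∀ u,
        pullback q w (β w) u = fderiv ℝ (Φ.φ i) (T w + b) (T u) + l (T u) := by
  obtain ⟨T, b, hT, hTw⟩ := hq.exists_affine hqc (Φ.chart_mem i) hv
  obtain ⟨l, hl⟩ := Φ.exists_coord_eq hβ hβL hqc hv
  refine ⟨T, b, l, hT, hTw.self_of_nhds.2.1, ?_⟩
  filter_upwards [hTw, hl] with w hw hlw u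
  obtain ⟨hw1, hw2, hw3⟩ := hw
  have h1 : pullback q w (β w) u = coord (Φ.chart i) (q w) (β w)
      (chartDeriv (Φ.chart i) (q w) (mapDeriv q w u)) := by
    rw [← ofCoord_apply, ofCoord_coord (Φ.chart_mem i) hw1]
    rfl
  rw [h1, hw3, hlw, hw2]
  rfl

/-- A lift to `T*B` of the Lagrangian section along a local affine isomorphism `ℝⁿ → B` is
strictly monotone. -/
theorem strictMono_lift {q : (Fin n → ℝ) → B} (hq : IsLocalAffineIso q)
    {β : ∀ w, Cotangent n (q w)}
    (hβ : Continuous fun w => (⟨q w, β w⟩ : CotangentBundle n B))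
    (hβL : ∀ w, toDualFibration (⟨q w, β w⟩ : CotangentBundle n B) ∈ Φ.lagrangian)
    (hqc : Continuous q) (v : Fin n → ℝ) {u : Fin n → ℝ} (hu : u ≠ 0) :
    StrictMono fun t : ℝ => pullback q (v + t • u) (β (v + t • u)) u := by
  -- Charts are needed only near one parameter at a time: the derivative at `t` is the Hessian of a
  -- local potential on `(T u, T u)`, positive as `T` is injective.
  refine strictMono_of_deriv_pos fun t => ?_
  obtain ⟨i, hi⟩ := Φ.cover (q (v + t • u))
  obtain ⟨T, b, l, hT, hp, hTw⟩ := Φ.exists_pullback_eq hq hβ hβL hqc hi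
  have hline : HasDerivAt (fun s : ℝ => v + s • u) u t := by
    simpa using ((hasDerivAt_id t).smul_const u).const_add v
  have hTu : T u ≠ 0 := fun h => hu (hT (h.trans (map_zero T).symm))
  have heq : (fun s : ℝ => pullback q (v + s • u) (β (v + s • u)) u) =ᶠ[𝓝 t]
      fun s => fderiv ℝ (Φ.φ i) (T (v + s • u) + b) (T u) + l (T u) :=
    (hline.continuousAt.eventually hTw).mono fun s hs => hs u
  have hd := Φ.differentiableAt_fderiv hi
  have h3 := Φ.hessian_pos hi hTu
  rw [hp] at hd h3
  have h1 : HasDerivAt (fun s : ℝ => T (v + s • u) + b) (T u) t :=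
    (T.hasFDerivAt.comp_hasDerivAt t hline).add_const b
  rw [heq.deriv_eq, ((hasDerivAt_apply_comp hd h1 (T u)).add_const (l (T u))).deriv]
  exact h3

theorem eq_of_lift_eq_zero {q : (Fin n → ℝ) → B} (hq : IsLocalAffineIso q)
    (hqc : Continuous q) {σ : (Fin n → ℝ) → CotangentBundle n B} (hσ : Continuous σ)
    (hσq : ∀ w, (σ w).proj = q w) (hσL : ∀ w, toDualFibration (σ w) ∈ Φ.lagrangian)
    {v w : Fin n → ℝ} (hv : σ v = ⟨q v, 0⟩) (hw : σ w = ⟨q w, 0⟩) : v = w := by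
  have hex (w : Fin n → ℝ) : ∃ b : Cotangent n (q w), σ w = ⟨q w, b⟩ := by
    rw [← hσq]
    exact ⟨_, rfl⟩
  choose β hβ using hex
  have hβσ : σ = fun w => (⟨q w, β w⟩ : CotangentBundle n B) := funext hβ
  have hzero {v : Fin n → ℝ} (hv : σ v = ⟨q v, 0⟩) : β v = 0 := by
    rw [hβ] at hv
    simpa using hv
  by_contra hne
  -- On the line from `v` (time 0) to `w` (time 1), strict growth contradicts the two zero values.
  have h := Φ.strictMono_lift hq (β := β) (hβσ ▸ hσ) (fun w => hβ w ▸ hσL w) hqc v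
    (sub_ne_zero.2 (Ne.symm hne)) zero_lt_one
  have hpull {x y : Fin n → ℝ} (hxy : x = y) (hy : σ y = ⟨q y, 0⟩) :
      pullback q x (β x) (w - v) = 0 := by
    subst hxy
    rw [hzero hy]
    rfl
  refine lt_irrefl (0 : ℝ) ?_
  calc (0 : ℝ) = _ := (hpull (by simp) hv).symm
    _ < _ := h
    _ = 0 := hpull (by simp) hw

end IntegralPotentials

end

/-! ### Intersection points on a lift to the path space -/

section

variable {n : ℕ} {B : Type*} [TopologicalSpace B] [ChartedSpace (Fin n → ℝ) B]
  [HasGroupoid B (specialIntegralAffineGroupoid n)]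

/-- A lift `ℝⁿ → P(L₀, L_g)` of a local affine isomorphism `ℝⁿ → B` passes through the intersection
points of `L₀` and `L_g` at most once. -/
theorem IntegralPotentials.eq_of_lift_eq_ofPoint {g : Metric n B} (Φ : IntegralPotentials g)
    {q : (Fin n → ℝ) → B} (hq : IsLocalAffineIso q) (hqc : Continuous q)
    {σ : (Fin n → ℝ) → PathSpace (zeroSection n B) Φ.lagrangian} (hσ : Continuous σ)
    (hσq : ∀ w, (σ w).proj = q w) {v w : Fin n → ℝ} {p p' : ↥(zeroSection n B ∩ Φ.lagrangian)}
    (hv : σ v = PathSpace.ofPoint p) (hw : σ w = PathSpace.ofPoint p') : v = w := by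
  let H := PathSpace.homeomorph Φ.injOn_proj_lagrangian
  have hzero {w : Fin n → ℝ} {p : ↥(zeroSection n B ∩ Φ.lagrangian)}
      (hw : σ w = PathSpace.ofPoint p) : (H (σ w)).1 = ⟨q w, 0⟩ := by
    have h : q w = p.1.proj := by
      rw [← hσq, hw]
      rfl
    rw [hw, h]
    exact PathSpace.homeomorph_ofPoint _ p
  exact Φ.eq_of_lift_eq_zero hq hqc (σ := fun w => (H (σ w)).1)
    (continuous_subtype_val.comp (H.continuous.comp hσ))
    (fun w => (PathSpace.proj_homeomorph _ _).trans (hσq w)) (fun w => (H (σ w)).2)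
    (hzero hv) (hzero hw)

theorem PathSpace.ofPoint_injective {L : Set (DualFibration n B)} :
    Function.Injective (PathSpace.ofPoint : ↥(zeroSection n B ∩ L) → _) := by
  intro p p' h
  have h' : p.1.proj = p'.1.proj := congrArg PathSpace.proj h
  obtain ⟨x, hx⟩ := p.2.1
  obtain ⟨y, hy⟩ := p'.2.1
  refine Subtype.ext ?_
  rw [← hx, ← hy] at h' ⊢
  have hxy : x = y := h'
  rw [hxy]

end

end SYZ

end

/-! ### The decomposition of the path space -/

theorem mainTheorem5 {n : ℕ} {B : Type*} [TopologicalSpace B] [T2Space B] [CompactSpace B]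
    [ChartedSpace (Fin n → ℝ) B] [HasGroupoid B (SYZ.specialIntegralAffineGroupoid n)]
    (hB : SYZ.IsCompleteAffine n B) (g : SYZ.Metric n B) (Φ : SYZ.IntegralPotentials g) :
    -- distinct intersection points lie in distinct components
    (∀ p q : ↥(SYZ.zeroSection n B ∩ Φ.lagrangian), p ≠ q →
      Disjoint (SYZ.PathSpace.component p) (SYZ.PathSpace.component q)) ∧
    -- each such component is open and closed, contractible, and affinely isomorphic to `ℝⁿ`
    (∀ p : ↥(SYZ.zeroSection n B ∩ Φ.lagrangian),
      IsClopen (SYZ.PathSpace.component p) ∧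
      ContractibleSpace ↥(SYZ.PathSpace.component p) ∧
      SYZ.PathSpace.IsAffinelyEuclidean (SYZ.PathSpace.component p)) ∧
    -- the rest of the path space is open and closed and contains no critical points
    (∃ P : Set (SYZ.PathSpace (SYZ.zeroSection n B) Φ.lagrangian),
      IsClopen P ∧ (∀ c ∈ P, ¬ SYZ.PathSpace.IsCritical c) ∧
      (∀ p : ↥(SYZ.zeroSection n B ∩ Φ.lagrangian), Disjoint P (SYZ.PathSpace.component p)) ∧
      P ∪ ⋃ p : ↥(SYZ.zeroSection n B ∩ Φ.lagrangian), SYZ.PathSpace.component p = Set.univ) := by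
  obtain ⟨q, hq, hqs, hqa⟩ := hB
  have hr := Φ.isCoveringMap_proj
  have hopen := SYZ.isOpen_connectedComponent_of_covering hq hqs hr
  have hlift (p : ↥(SYZ.zeroSection n B ∩ Φ.lagrangian)) :
      ∃ (σ : (Fin n → ℝ) → SYZ.PathSpace (SYZ.zeroSection n B) Φ.lagrangian) (v : Fin n → ℝ),
        Continuous σ ∧ (∀ w, (σ w).proj = q w) ∧ σ v = SYZ.PathSpace.ofPoint p := by
    obtain ⟨v, hv⟩ := hqs (SYZ.PathSpace.ofPoint p).proj
    obtain ⟨σ, hσ⟩ := SYZ.exists_lift_through hq.continuous hr hv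
    exact ⟨σ, v, hσ⟩
  refine ⟨fun p p' hpp' => ?_, fun p => ?_, ?_⟩
  -- If the components coincide, the sheet through `p` also reaches `p'`; both are zeros of one
  -- lifted field, so they have the same parameter.
  · refine connectedComponent_disjoint fun h => hpp' ?_
    obtain ⟨σ, v, hσ, hσq, hv⟩ := hlift p
    have hmem : SYZ.PathSpace.ofPoint p' ∈ Set.range σ := by
      rw [← SYZ.connectedComponent_eq_range hq hqs hr hσ hσq v, hv, h]
      exact mem_connectedComponent
    obtain ⟨w, hw⟩ := hmem
    apply SYZ.PathSpace.ofPoint_injective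
    rw [← hv, ← hw, Φ.eq_of_lift_eq_ofPoint hqa hq.continuous hσ hσq hv hw]
  · obtain ⟨σ, v, hσ, hσq, hv⟩ := hlift p
    have hex := SYZ.exists_homeomorph_connectedComponent hq hqs hr hσ hσq (v := v)
      fun w hw => Φ.eq_of_lift_eq_ofPoint hqa hq.continuous hσ hσq (hw.trans hv) hv
    rw [hv] at hex
    obtain ⟨h, hh⟩ := hex
    refine ⟨⟨isClosed_connectedComponent, hopen _⟩, h.symm.contractibleSpace, h, ?_⟩
    -- The projection of the homeomorphism to `B` is `q` itself, so affineness is inherited from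
    -- `q`.
    exact Set.mem_of_eq_of_mem (s := {f | SYZ.IsLocalAffineIso f}) (funext hh) hqa
  · refine ⟨(⋃ p, SYZ.PathSpace.component p)ᶜ,
      (SYZ.isClopen_iUnion_connectedComponent hopen _).compl, fun c hc hcrit => hc ?_,
      fun p => ?_, Set.compl_union_self _⟩
    · obtain ⟨p, rfl⟩ := hcrit.exists_eq_ofPoint Φ.injOn_proj_lagrangian
      exact Set.mem_iUnion.2 ⟨p, mem_connectedComponent⟩
    · exact Set.disjoint_compl_left_iff_subset.2
        (Set.subset_iUnion (fun p => SYZ.PathSpace.component p) p)
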